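/- **Theorem (notched angle).** Let $\alpha,\beta>0$ with $\alpha+\beta<\pi$. Let $AOB$ and $A'OB'$ be isosceles triangles with common apex $O$, with horizontal bases $AB\subset A'B'$ on the same line, with $O$ above it, and with $\angle AOB=\alpha$, $\angle A'OB'=\alpha+\beta$. From $B$ draw the broken line with alternately vertical and horizontal segments, beginning with a vertical one, whose successive vertices lie alternately on $OB$ and $OB'$ and converge to $O$; from $A$ draw its mirror image, with vertices on $OA$ and $OA'$. The *notched angle* of size $(\alpha,\beta)$ is the region $\Omega=\Omega_{\alpha,\beta}$ bounded by $AB$ and the two broken lines, with opening $I=AB$ and outer normal $n=(0,-1)$ at the opening. A billiard particle enters $\Omega$ through $I$ at the point with uniform coordinate $\xi\in[0,1]$ ($\xi=0$ at $A$, $\xi=1$ at $B$), with velocity obtained by rotating $-n$ counterclockwise by $\varphi\in[-\pi/2,\pi/2]$; it moves uniformly in $\Omega$, is reflected elastically by the two broken lines, and leaves $\Omega$ through $I$ with velocity obtained by rotating $n$ counterclockwise by $\varphi^+=\varphi^+_{\alpha,\beta}(\xi,\varphi)\in[-\pi/2,\pi/2]$. (Particles that hit a vertex of the boundary or never leave $\Omega$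 are excluded from consideration.) Let $d\mu(\xi,\varphi)=\tfrac12\cos\varphi\,d\xi\,d\varphi$ on $[0,1]\times[-\pi/2,\pi/2]$, and let the measure $\eta_{\alpha,\beta}$ on $[-\pi/2,\pi/2]^2$ generated by the notched angle be the push-forward of $\mu$ under $(\xi,\varphi)\mapsto(\varphi,\varphi^+_{\alpha,\beta}(\xi,\varphi))$. Let the retroreflector measure $\eta_\star$ be the push-forward of $\tfrac12\cos\varphi\,d\varphi$ on $[-\pi/2,\pi/2]$ under $\varphi\mapsto(\varphi,\varphi)$. Then there is a function $\beta=\beta(\alpha)$, $0<\alpha<\pi$, with $\beta(\alpha)>0$ and $\alpha+\beta(\alpha)<\pi$, such that $\lim_{\alpha\to0^+}\beta(\alpha)/\alpha=0$ and $\eta_{\alpha,\beta(\alpha)}$ converges to $\eta_\star$ in norm (total variation) as $\alpha\to0^+$. -/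

import Mathlib

open MeasureTheory Set Filter Topology

noncomputable section

namespace NotchedAngle

/-! ### Billiards in a plane hollow

The Euclidean plane is `ℂ`. A hollow is an open set `Ω ⊆ ℂ` together with an opening, the segment
with endpoints `P` and `Q`, where `Ω` lies to the left of the direction from `P` to `Q`. -/

/-- `p` is a point of the boundary of `Ω` near which the boundary is a straight line,
and `ν` is the outer unit normal there: near `p`, the set `Ω` is an open half-plane. -/
def IsFlatBoundaryPoint (Ω : Set ℂ) (p ν : ℂ) : Prop :=
  ‖ν‖ = 1 ∧ ∃ r > 0, ∀ z ∈ Metric.ball p r, z ∈ Ω ↔ inner ℝ (z - p) ν < 0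

/-- The elastic reflection of the velocity `v` from a wall with unit normal `ν`. -/
def reflect (v ν : ℂ) : ℂ := v - (2 * inner ℝ v ν) • ν

/-- A billiard trajectory in the polygonal (possibly infinitely-sided) hollow `Ω` with opening `PQ`
which enters through the opening at `p 0`, is reflected at `p 1, …, p N` and leaves through the
opening at `p (N + 1)`. The velocity between `p k` and `p (k + 1)` is `v k`. The trajectory is not
allowed to hit a singular point of the boundary. -/
structure IsBilliardPath (Ω : Set ℂ) (P Q : ℂ) (N : ℕ) (p v : ℕ → ℂ) : Prop where
  enter : p 0 ∈ openSegment ℝ P Q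
  flight : ∀ k ≤ N, (∃ t : ℝ, 0 < t ∧ p (k + 1) = p k + t • v k) ∧
    openSegment ℝ (p k) (p (k + 1)) ⊆ Ω
  reflection : ∀ k < N, p (k + 1) ∉ openSegment ℝ P Q ∧
    ∃ ν : ℂ, IsFlatBoundaryPoint Ω (p (k + 1)) ν ∧ v (k + 1) = reflect (v k) ν
  leave : p (N + 1) ∈ openSegment ℝ P Q

/-- The outer unit normal `n` at the opening `PQ`. -/
def outerNormal (P Q : ℂ) : ℂ := -Complex.I * ((Q - P) / (‖Q - P‖ : ℂ))

/-- The vector `u` rotated counterclockwise by the angle `φ`. -/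
def rotate (u : ℂ) (φ : ℝ) : ℂ := u * Complex.exp ((φ : ℂ) * Complex.I)

/-- A particle which enters the hollow at the point of the opening with uniform coordinate `ξ`
(`ξ = 0` at `P`, `ξ = 1` at `Q`), with velocity `-n` rotated counterclockwise by `φ`, eventually
leaves the hollow, and its final velocity is `n` rotated counterclockwise by
`ψ ∈ [-π/2, π/2]`. -/
def Scatters (Ω : Set ℂ) (P Q : ℂ) (ξ φ ψ : ℝ) : Prop :=
  ψ ∈ Icc (-(Real.pi / 2)) (Real.pi / 2) ∧
  ∃ (N : ℕ) (p v : ℕ → ℂ), IsBilliardPath Ω P Q N p v ∧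
    p 0 = P + ξ • (Q - P) ∧
    v 0 = rotate (-outerNormal P Q) φ ∧
    v N = rotate (outerNormal P Q) ψ

/-- The initial data `(ξ, φ)` of the particles that eventually leave the hollow. The other
("pathological") particles hit a singular point of the boundary or are trapped. -/
def regularData (Ω : Set ℂ) (P Q : ℂ) : Set (ℝ × ℝ) :=
  {x | ∃ ψ : ℝ, Scatters Ω P Q x.1 x.2 ψ}

open Classical in
/-- The exit angle `φ⁺(ξ, φ)`; only its values on `regularData` matter. -/
def exitAngle (Ω : Set ℂ) (P Q : ℂ) (x : ℝ × ℝ) : ℝ :=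
  if h : ∃ ψ : ℝ, Scatters Ω P Q x.1 x.2 ψ then h.choose else 0

/-! ### Measures -/

/-- The measure `½ cos φ dφ` on `[-π/2, π/2]`. -/
def angleMeasure : Measure ℝ :=
  (volume.restrict (Icc (-(Real.pi / 2)) (Real.pi / 2))).withDensity
    fun φ => ENNReal.ofReal (Real.cos φ / 2)

instance : IsFiniteMeasure angleMeasure := by
  refine isFiniteMeasure_withDensity_ofReal ?_
  have h : Continuous fun φ : ℝ => Real.cos φ / 2 := by fun_prop
  exact h.integrableOn_Icc.hasFiniteIntegral

/-- The measure `dμ(ξ, φ) = ½ cos φ dξ dφ` on `[0, 1] × [-π/2, π/2]`. -/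
def initialMeasure : Measure (ℝ × ℝ) :=
  (volume.restrict (Icc (0 : ℝ) 1)).prod angleMeasure

instance : IsFiniteMeasure initialMeasure := by
  unfold initialMeasure; infer_instance

/-- The measure generated by the hollow `(Ω, PQ)`: the image of `μ`, pathological particles being
excluded, under the map `(ξ, φ) ↦ (φ, φ⁺(ξ, φ))`. It is carried by `[-π/2, π/2]²`. -/
def generatedMeasure (Ω : Set ℂ) (P Q : ℂ) : Measure (ℝ × ℝ) :=
  (initialMeasure.restrict (regularData Ω P Q)).map fun x => (x.2, exitAngle Ω P Q x)

instance (Ω : Set ℂ) (P Q : ℂ) : IsFiniteMeasure (generatedMeasure Ω P Q) := by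
  unfold generatedMeasure; infer_instance

/-- The retroreflector measure `η⋆`, with density `½ cos φ δ(φ - φ⁺)`. -/
def retroMeasure : Measure (ℝ × ℝ) :=
  angleMeasure.map fun φ => (φ, φ)

instance : IsFiniteMeasure retroMeasure := by
  unfold retroMeasure; infer_instance

/-- The distance between two finite measures in norm, i.e. the total variation of `μ - ν`. -/
def normDist {X : Type*} [MeasurableSpace X] (μ ν : Measure X)
    [IsFiniteMeasure μ] [IsFiniteMeasure ν] : ENNReal :=
  (μ.toSignedMeasure - ν.toSignedMeasure).totalVariation univ

/-! ### The notched angle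

The common apex `O` is `0` and both bases lie on the line `Im z = -1`, so that
`A, B = ∓tan(α/2) - i` and `A', B' = ∓tan((α+β)/2) - i`. With `a = tan(α/2)` and
`q = tan(α/2) / tan((α+β)/2)`, the broken line starting at `B` has the successive vertices
`a - i`, `a - q i`, `a q - q i`, `a q - q² i`, `a q² - q² i`, …, alternately on `OB` and `OB'`;
the broken line starting at `A` is its mirror image. -/

/-- The left endpoint `A` of the opening. -/
def ptA (α : ℝ) : ℂ := ⟨-Real.tan (α / 2), -1⟩

/-- The right endpoint `B` of the opening. -/
def ptB (α : ℝ) : ℂ := ⟨Real.tan (α / 2), -1⟩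

/-- The ratio of successive steps of the broken lines. -/
def ratio (α β : ℝ) : ℝ := Real.tan (α / 2) / Real.tan ((α + β) / 2)

/-- The open region bounded by `AB` and the two broken lines: at the heights
`-q ^ n ≤ Im z < -q ^ (n + 1)` its cross-section is `|Re z| < tan(α/2) q ^ n`. -/
def region (α β : ℝ) : Set ℂ :=
  {z | -1 < z.im ∧ ∃ n : ℕ, -ratio α β ^ n ≤ z.im ∧ z.im < -ratio α β ^ (n + 1) ∧
    |z.re| < Real.tan (α / 2) * ratio α β ^ n}

/-- The measure `η_{α,β}` generated by the `(α, β)`-angle. -/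
def eta (α β : ℝ) : Measure (ℝ × ℝ) :=
  generatedMeasure (region α β) (ptA α) (ptB α)

instance (α β : ℝ) : IsFiniteMeasure (eta α β) := by
  unfold eta; infer_instance

end NotchedAngle

end

/-! Fix α and let β → 0, so that the ratio q of consecutive steps tends to 1. In the coordinates (a
y, -r), a = tan(α/2), the slope τ keeps its absolute value: a vertical wall reverses its sign, a
ceiling reverses only the vertical direction. A particle that turns back at one ceiling therefore
retraces its incoming direction exactly when it meets an odd number of vertical walls.

This parity comes from an adiabatic invariant. Free flights conserve τ y + τ² r on the way up and -τ
y + τ² r on the way down. Every reflection, at a wall or at a ceiling, takes place where q|y| ≤ r ≤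
|y|, and so, up to an error that vanishes as q → 1, it multiplies or divides the quantity by ρ =
(|τ| - 1)/(|τ| + 1) (`moment_step`, `dualMoment_step`, `moment_turn`). At the opening the quantity
lies between |τ|(|τ| - 1) and |τ|(|τ| + 1), a fundamental domain for multiplication by ρ. Hence the
way in and the way out use equally many factors ρ (`exponent_unique`). The ceiling supplies one of
them, so the two numbers of walls differ by one and their sum is odd (`down_up_fst_of_close`).

The argument works for fixed initial data with |τ| > 1, |y| < 1 and q → 1, as long as the particle
turns back before r drops below a fixed h. The other particles are few: |τ| ≤ 1 means |φ| ≤ α/2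
(`measure_flat_angles_le`); the motion preserves dν(τ) dy, so a mass O(h) gets deeper than h
(`measure_alive_le`); the rest vanishes by dominated convergence (`tendsto_measure_defect`). For
each α one takes β so small that the exceptional mass is at most 2α and β ≤ α² (`exists_size`); the
distance in norm is at most twice the exceptional mass (`normDist_map_le`). -/

noncomputable section

namespace NotchedAngle

section Trajectories

/-! ### Exit velocities of billiard trajectories -/

/-- The particle which starts at `p` with velocity `v` is finitely many times reflected at
regular boundary points of `Ω` and then leaves through the opening `PQ` with velocity `w`. -/
inductive Exits (Ω : Set ℂ) (P Q : ℂ) : ℂ → ℂ → ℂ → Prop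
  | leave {p v : ℂ} {t : ℝ} (ht : 0 < t) (hs : ∀ s ∈ Ioo 0 t, p + s • v ∈ Ω)
      (hp : p + t • v ∈ openSegment ℝ P Q) : Exits Ω P Q p v v
  | bounce {p v w ν : ℂ} {t : ℝ} (ht : 0 < t) (hs : ∀ s ∈ Ioo 0 t, p + s • v ∈ Ω)
      (hp : p + t • v ∉ openSegment ℝ P Q) (hν : IsFlatBoundaryPoint Ω (p + t • v) ν)
      (h : Exits Ω P Q (p + t • v) (reflect v ν) w) : Exits Ω P Q p v w

variable {Ω : Set ℂ} {P Q p v w ν : ℂ}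

theorem openSegment_add_smul_subset_iff {t : ℝ} (ht : 0 < t) :
    openSegment ℝ p (p + t • v) ⊆ Ω ↔ ∀ s ∈ Ioo 0 t, p + s • v ∈ Ω := by
  rw [openSegment_eq_image', image_subset_iff]
  constructor
  · intro h s hs
    have := h (show s / t ∈ Ioo (0 : ℝ) 1 from ⟨div_pos hs.1 ht, (div_lt_one ht).2 hs.2⟩)
    rwa [mem_preimage, add_sub_cancel_left, smul_smul, div_mul_cancel₀ _ ht.ne'] at this
  · intro h θ hθ
    have := h (θ * t) ⟨mul_pos hθ.1 ht, by nlinarith [hθ.2]⟩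
    rwa [mem_preimage, add_sub_cancel_left, smul_smul]

theorem exits_of_path {N : ℕ} {p v : ℕ → ℂ}
    (flight : ∀ k ≤ N, (∃ t : ℝ, 0 < t ∧ p (k + 1) = p k + t • v k) ∧
      openSegment ℝ (p k) (p (k + 1)) ⊆ Ω)
    (reflection : ∀ k < N, p (k + 1) ∉ openSegment ℝ P Q ∧
      ∃ ν : ℂ, IsFlatBoundaryPoint Ω (p (k + 1)) ν ∧ v (k + 1) = reflect (v k) ν)
    (leave : p (N + 1) ∈ openSegment ℝ P Q) : Exits Ω P Q (p 0) (v 0) (v N) := by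
  induction N generalizing p v with
  | zero =>
    obtain ⟨⟨t, ht, h⟩, hs⟩ := flight 0 le_rfl
    rw [h] at hs leave
    exact .leave ht ((openSegment_add_smul_subset_iff ht).1 hs) leave
  | succ N ih =>
    obtain ⟨⟨t, ht, h⟩, hs⟩ := flight 0 (Nat.zero_le _)
    obtain ⟨hp, ν, hν, hv⟩ := reflection 0 (Nat.succ_pos _)
    have key := ih (p := fun k => p (k + 1)) (v := fun k => v (k + 1))
      (fun k hk => flight (k + 1) (by omega)) (fun k hk => reflection (k + 1) (by omega)) leave
    simp only [zero_add] at h hs hp hν hv key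
    rw [h] at hs hp hν key
    rw [hv] at key
    exact .bounce ht ((openSegment_add_smul_subset_iff ht).1 hs) hp hν key

theorem Exits.exists_path (h : Exits Ω P Q p v w) : ∃ (N : ℕ) (x u : ℕ → ℂ),
    x 0 = p ∧ u 0 = v ∧ u N = w ∧
    (∀ k ≤ N, (∃ t : ℝ, 0 < t ∧ x (k + 1) = x k + t • u k) ∧
      openSegment ℝ (x k) (x (k + 1)) ⊆ Ω) ∧
    (∀ k < N, x (k + 1) ∉ openSegment ℝ P Q ∧
      ∃ ν : ℂ, IsFlatBoundaryPoint Ω (x (k + 1)) ν ∧ u (k + 1) = reflect (u k) ν) ∧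
    x (N + 1) ∈ openSegment ℝ P Q := by
  induction h with
  | @leave p v t ht hs hp =>
    refine ⟨0, fun k => Nat.casesOn k p fun _ => p + t • v, fun _ => v, rfl, rfl, rfl, ?_, ?_, hp⟩
    · intro k hk
      obtain rfl : k = 0 := by omega
      exact ⟨⟨t, ht, rfl⟩, (openSegment_add_smul_subset_iff ht).2 hs⟩
    · intro k hk
      omega
  | @bounce p v w ν t ht hs hp hν h ih =>
    obtain ⟨N, x, u, hx, hu, huN, hf, hr, hl⟩ := ih
    refine ⟨N + 1, fun k => Nat.casesOn k p x, fun k => Nat.casesOn k v u, rfl, rfl, huN,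
      ?_, ?_, hl⟩
    · rintro (_ | k) hk
      · refine ⟨⟨t, ht, hx⟩, ?_⟩
        change openSegment ℝ p (x 0) ⊆ Ω
        rw [hx]
        exact (openSegment_add_smul_subset_iff ht).2 hs
      · exact hf k (by omega)
    · rintro (_ | k) hk
      · change x 0 ∉ _ ∧ ∃ ν, IsFlatBoundaryPoint Ω (x 0) ν ∧ u 0 = reflect v ν
        rw [hx, hu]
        exact ⟨hp, ν, hν, rfl⟩
      · exact hr k (by omega)

theorem scatters_iff {ξ φ ψ : ℝ} : Scatters Ω P Q ξ φ ψ ↔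
    ψ ∈ Icc (-(Real.pi / 2)) (Real.pi / 2) ∧ P + ξ • (Q - P) ∈ openSegment ℝ P Q ∧
    Exits Ω P Q (P + ξ • (Q - P)) (rotate (-outerNormal P Q) φ) (rotate (outerNormal P Q) ψ) := by
  constructor
  · rintro ⟨hψ, N, p, v, h, hp, hv, hN⟩
    refine ⟨hψ, hp ▸ h.enter, ?_⟩
    rw [← hp, ← hv, ← hN]
    exact exits_of_path h.flight h.reflection h.leave
  · rintro ⟨hψ, hp, h⟩
    obtain ⟨N, x, u, hx, hu, huN, hf, hr, hl⟩ := h.exists_path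
    exact ⟨hψ, N, x, u, ⟨hx ▸ hp, hf, hr, hl⟩, hx, hu, huN⟩

theorem IsFlatBoundaryPoint.notMem (h : IsFlatBoundaryPoint Ω p ν) : p ∉ Ω := by
  obtain ⟨-, r, hr, h⟩ := h
  simp [h p (Metric.mem_ball_self hr)]

theorem IsFlatBoundaryPoint.eventually_iff (h : IsFlatBoundaryPoint Ω p ν) (d : ℂ) :
    ∀ᶠ s in 𝓝[>] (0 : ℝ), (p + s • d ∈ Ω ↔ inner ℝ d ν < 0) := by
  obtain ⟨-, r, hr, h⟩ := h
  have hc : Tendsto (fun s : ℝ => p + s • d) (𝓝[>] 0) (𝓝 p) := by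
    have : Continuous fun s : ℝ => p + s • d := by fun_prop
    simpa using (this.tendsto 0).mono_left nhdsWithin_le_nhds
  filter_upwards [hc (Metric.ball_mem_nhds p hr), self_mem_nhdsWithin] with s hs hs0
  rw [h _ hs, add_sub_cancel_left, real_inner_smul_left]
  have hs0 : 0 < s := hs0
  constructor
  · intro h; by_contra! h'; nlinarith
  · intro h; nlinarith

theorem IsFlatBoundaryPoint.normal_unique {ν' : ℂ} (h : IsFlatBoundaryPoint Ω p ν)
    (h' : IsFlatBoundaryPoint Ω p ν') : ν = ν' := by
  -- The test direction ν' - ν has a product ≤ 0 with ν and the opposite product with ν'; since the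
  -- two half-planes agree, both products vanish.
  have key : inner ℝ (ν' - ν) ν < 0 ↔ inner ℝ (ν' - ν) ν' < 0 := by
    obtain ⟨s, h1, h2⟩ := ((h.eventually_iff (ν' - ν)).and (h'.eventually_iff (ν' - ν))).exists
    exact h1.symm.trans h2
  rw [inner_sub_left, inner_sub_left, real_inner_self_eq_norm_sq, real_inner_self_eq_norm_sq,
    h.1, h'.1, real_inner_comm] at key
  have hle : inner ℝ ν ν' ≤ 1 := by
    simpa [h.1, h'.1] using real_inner_le_norm ν ν'
  refine (inner_eq_one_iff_of_norm_eq_one h.1 h'.1).1 (le_antisymm hle ?_)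
  by_contra! hlt
  have := key.1 (by linarith)
  linarith

/-- Lets a perturbed trajectory that lands on the same straight piece be reflected with the same
normal. -/
theorem IsFlatBoundaryPoint.eventually_flat (h : IsFlatBoundaryPoint Ω p ν) :
    ∀ᶠ z in 𝓝 p, inner ℝ (z - p) ν = 0 → IsFlatBoundaryPoint Ω z ν := by
  obtain ⟨h1, r, hr, h⟩ := h
  filter_upwards [Metric.ball_mem_nhds p (half_pos hr)] with z hz hz0
  refine ⟨h1, r / 2, half_pos hr, fun y hy => ?_⟩
  rw [h y]
  · rw [← sub_add_sub_cancel y z p, inner_add_left, hz0, add_zero]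
  · rw [Metric.mem_ball] at *
    linarith [dist_triangle y z p]

theorem norm_reflect (hν : ‖ν‖ = 1) : ‖reflect v ν‖ = ‖v‖ := by
  have h : ‖reflect v ν‖ ^ 2 = ‖v‖ ^ 2 := by
    rw [reflect, norm_sub_sq_real, norm_smul, real_inner_smul_right, hν, Real.norm_eq_abs, mul_one,
      sq_abs]
    ring
  exact (pow_left_inj₀ (norm_nonneg _) (norm_nonneg _) two_ne_zero).1 h

theorem Exits.norm_eq (h : Exits Ω P Q p v w) : ‖w‖ = ‖v‖ := by
  induction h with
  | leave => rfl
  | bounce ht hs hp hν h ih => rw [ih, norm_reflect hν.1]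

theorem Exits.exists_leave (h : Exits Ω P Q p v w) :
    ∃ z ∈ openSegment ℝ P Q, ∃ t : ℝ, 0 < t ∧ ∀ s ∈ Ioo 0 t, z + s • (-w) ∈ Ω := by
  induction h with
  | @leave p v t ht hs hp =>
    refine ⟨_, hp, t, ht, fun s hs' => ?_⟩
    convert hs (t - s) ⟨by linarith [hs'.2], by linarith [hs'.1]⟩ using 1
    rw [sub_smul, smul_neg]; ring
  | bounce ht hs hp hν h ih => exact ih

/-- Points of the opening and flat boundary points lie outside Ω, so a flight must stop at the first
of them; its duration, and then the normal, are determined. This makes the choice in `exitAngle`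
immaterial. -/
theorem Exits.unique (hopen : ∀ z ∈ openSegment ℝ P Q, z ∉ Ω) (h : Exits Ω P Q p v w) {w' : ℂ}
    (h' : Exits Ω P Q p v w') : w = w' := by
  have time : ∀ {p v : ℂ} {t t' : ℝ}, 0 < t → (∀ s ∈ Ioo 0 t', p + s • v ∈ Ω) →
      p + t • v ∉ Ω → t' ≤ t := by
    intro p v t t' ht hs hp
    by_contra! hlt
    exact hp (hs t ⟨ht, hlt⟩)
  induction h with
  | @leave p v t ht hs hp =>
    cases h' with
    | leave => rfl
    | @bounce _ _ _ ν t' ht' hs' hp' hν' h' =>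
      obtain rfl : t = t' := le_antisymm (time ht' hs hν'.notMem) (time ht hs' (hopen _ hp))
      exact absurd hp hp'
  | @bounce p v w ν t ht hs hp hν h ih =>
    cases h' with
    | @leave _ _ t' ht' hs' hp' =>
      obtain rfl : t = t' := le_antisymm (time ht' hs (hopen _ hp')) (time ht hs' hν.notMem)
      exact absurd hp' hp
    | @bounce _ _ _ ν' t' ht' hs' hp' hν' h' =>
      obtain rfl : t = t' := le_antisymm (time ht' hs hν'.notMem) (time ht hs' hν.notMem)
      rw [← hν.normal_unique hν'] at h'
      exact ih h'

/-- A free flight inside `Ω` may be prepended to a trajectory. -/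
theorem Exits.extend {t : ℝ} (ht : 0 < t) (hs : ∀ s ∈ Ioc 0 t, p + s • v ∈ Ω)
    (h : Exits Ω P Q (p + t • v) v w) : Exits Ω P Q p v w := by
  have key : ∀ {t' : ℝ}, 0 < t' → (∀ s ∈ Ioo 0 t', p + t • v + s • v ∈ Ω) →
      ∀ s ∈ Ioo 0 (t + t'), p + s • v ∈ Ω := by
    intro t' ht' hs' s h
    rcases le_or_gt s t with hst | hst
    · exact hs s ⟨h.1, hst⟩
    · convert hs' (s - t) ⟨by linarith, by linarith [h.2]⟩ using 1
      rw [sub_smul]; ring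
  have eq : ∀ t' : ℝ, p + t • v + t' • v = p + (t + t') • v := fun t' => by
    rw [add_smul, add_assoc]
  cases h with
  | @leave _ _ t' ht' hs' hp' =>
    rw [eq] at hp'
    exact .leave (add_pos ht ht') (key ht' hs') hp'
  | @bounce _ _ _ ν t' ht' hs' hp' hν' h' =>
    rw [eq] at hp' hν' h'
    exact .bounce (add_pos ht ht') (key ht' hs') hp' hν' h'

theorem IsFlatBoundaryPoint.inner_neg_of_flight (h : IsFlatBoundaryPoint Ω p ν) {t : ℝ}
    (ht : 0 < t) (hs : ∀ s ∈ Ioo 0 t, p + s • v ∈ Ω) : inner ℝ v ν < 0 := by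
  obtain ⟨s, h1, h2⟩ := ((h.eventually_iff v).and (Ioo_mem_nhdsGT ht)).exists
  exact h1.1 (hs s h2)

/-! ### Stability of trajectories under perturbation of the initial data -/

variable {X : Type*} {l : Filter X} {pX vX : X → ℂ}

/-- A free flight between two regular boundary points is stable under perturbations. -/
theorem flight_stable {ν₀ : ℂ} {t : ℝ} (hΩ : IsOpen Ω) (h₀ : IsFlatBoundaryPoint Ω p ν₀)
    (ht : 0 < t) (hs : ∀ s ∈ Ioo 0 t, p + s • v ∈ Ω) (h₁ : IsFlatBoundaryPoint Ω (p + t • v) ν)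
    (hp : Tendsto pX l (𝓝 p)) (hv : Tendsto vX l (𝓝 v))
    (hpν : ∀ᶠ x in l, inner ℝ (pX x - p) ν₀ = 0) :
    ∃ T : X → ℝ, Tendsto T l (𝓝 t) ∧ ∀ᶠ x in l, 0 < T x ∧
      (∀ s ∈ Ioo 0 (T x), pX x + s • vX x ∈ Ω) ∧
      inner ℝ (pX x + T x • vX x - (p + t • v)) ν = 0 := by
  have hv₀ : inner ℝ v ν₀ < 0 := h₀.inner_neg_of_flight ht hs
  have hv₁ : 0 < inner ℝ v ν := by
    have := h₁.inner_neg_of_flight (v := -v) ht fun s hs' => by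
      convert hs (t - s) ⟨by linarith [hs'.2], by linarith [hs'.1]⟩ using 1
      rw [sub_smul, smul_neg]; ring
    rw [inner_neg_left] at this
    linarith
  obtain ⟨-, r₀, hr₀, h₀⟩ := h₀
  obtain ⟨-, r₁, hr₁, h₁⟩ := h₁
  have hcont : ∀ u : ℝ, Tendsto (fun y : X × ℝ => pX y.1 + y.2 • vX y.1) (l ×ˢ 𝓝 u)
      (𝓝 (p + u • v)) := fun u =>
    (hp.comp tendsto_fst).add (tendsto_snd.smul (hv.comp tendsto_fst))
  have hvν : Tendsto (fun x => inner ℝ (vX x) ν) l (𝓝 (inner ℝ v ν)) := hv.inner tendsto_const_nhds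
  -- The perturbed flight is stopped when it crosses the tangent line at the original end point.
  have hT : Tendsto (fun x => inner ℝ (p + t • v - pX x) ν / inner ℝ (vX x) ν) l (𝓝 t) := by
    have := ((tendsto_const_nhds (x := p + t • v)).sub hp).inner (𝕜 := ℝ)
      (tendsto_const_nhds (x := ν))
    have h := this.div hvν hv₁.ne'
    rwa [add_sub_cancel_left, real_inner_smul_left, mul_div_assoc, div_self hv₁.ne', mul_one] at h
  set T : X → ℝ := fun x => inner ℝ (p + t • v - pX x) ν / inner ℝ (vX x) ν with hTdef
  refine ⟨T, hT, ?_⟩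
  have hloc : ∀ u r : ℝ, 0 < r → ∃ ε > 0, ∀ᶠ x in l, ∀ s, |s - u| < ε →
      pX x + s • vX x ∈ Metric.ball (p + u • v) r := by
    intro u r hr
    obtain ⟨A, hA, B, hB, hAB⟩ := Filter.mem_prod_iff.1 (hcont u (Metric.ball_mem_nhds _ hr))
    obtain ⟨ε, hε, hB⟩ := Metric.mem_nhds_iff.1 hB
    refine ⟨ε, hε, ?_⟩
    filter_upwards [hA] with x hx s hs'
    exact hAB (mk_mem_prod hx (hB (by simpa [Real.dist_eq] using hs')))
  obtain ⟨ε₀, hε₀, H₀⟩ := hloc 0 r₀ hr₀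
  obtain ⟨ε₁, hε₁, H₁⟩ := hloc t r₁ hr₁
  -- Near both ends the boundary is straight and membership is decided by the sign of an inner
  -- product; the middle part is compact in the open set Ω and has room to spare.
  set K : Set ℂ := (fun s : ℝ => p + s • v) '' Icc (min ε₀ t / 2) (t - min ε₁ t / 2) with hK
  have hm₀ : 0 < min ε₀ t := lt_min hε₀ ht
  have hm₁ : 0 < min ε₁ t := lt_min hε₁ ht
  have hKc : IsCompact K := isCompact_Icc.image (by fun_prop)
  have hKΩ : K ⊆ Ω := by
    rintro _ ⟨s, hs', rfl⟩
    exact hs s ⟨by linarith [hs'.1], by linarith [hs'.2]⟩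
  obtain ⟨ε, hε, hthick⟩ := hKc.exists_thickening_subset_open hΩ hKΩ
  have hclose : ∀ᶠ x in l, ‖pX x - p‖ + t * ‖vX x - v‖ < ε := by
    have : Tendsto (fun x => ‖pX x - p‖ + t * ‖vX x - v‖) l (𝓝 (‖p - p‖ + t * ‖v - v‖)) :=
      (hp.sub tendsto_const_nhds).norm.add ((hv.sub tendsto_const_nhds).norm.const_mul t)
    refine this.eventually_lt_const ?_
    simpa using hε
  filter_upwards [H₀, H₁, hclose, hpν, hvν.eventually_const_lt hv₁,
    (hv.inner (𝕜 := ℝ) (tendsto_const_nhds (x := ν₀))).eventually_lt_const hv₀,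
    hT.eventually_const_lt ht, hT.eventually_lt_const (show t < t + min ε₁ t / 2 by linarith)]
    with x H₀ H₁ hclose hpν hvν hvν₀ hT0 hTt
  have hTx : T x * inner ℝ (vX x) ν = inner ℝ (p + t • v - pX x) ν := div_mul_cancel₀ _ hvν.ne'
  have hin : ∀ s : ℝ, inner ℝ (pX x + s • vX x - (p + t • v)) ν
      = (s - T x) * inner ℝ (vX x) ν := by
    intro s
    rw [sub_mul, hTx, ← real_inner_smul_left, ← inner_sub_left]
    congr 1; ring
  refine ⟨hT0, fun s hs' => ?_, by rw [hin]; simp⟩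
  by_cases c₀ : s < min ε₀ t / 2
  · have hb := H₀ s (by rw [sub_zero, abs_of_pos hs'.1]; linarith [min_le_left ε₀ t])
    rw [zero_smul, add_zero] at hb
    rw [h₀ _ hb, add_sub_right_comm, inner_add_left, hpν, real_inner_smul_left, zero_add]
    exact mul_neg_of_pos_of_neg hs'.1 hvν₀
  by_cases c₁ : t - min ε₁ t / 2 < s
  · have hb := H₁ s (by
      rw [abs_lt]
      constructor <;> linarith [min_le_left ε₁ t, hs'.2])
    rw [h₁ _ hb, hin]
    exact mul_neg_of_neg_of_pos (by linarith [hs'.2]) hvν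
  · refine hthick (Metric.mem_thickening_iff.2
      ⟨p + s • v, ⟨s, ⟨not_lt.1 c₀, not_lt.1 c₁⟩, rfl⟩, ?_⟩)
    rw [dist_eq_norm]
    calc ‖pX x + s • vX x - (p + s • v)‖ = ‖(pX x - p) + s • (vX x - v)‖ := by
          congr 1; rw [smul_sub]; ring
      _ ≤ ‖pX x - p‖ + s * ‖vX x - v‖ := by
          refine (norm_add_le _ _).trans ?_
          rw [norm_smul, Real.norm_of_nonneg hs'.1.le]
      _ ≤ ‖pX x - p‖ + t * ‖vX x - v‖ := by
          gcongr
          linarith [not_lt.1 c₁]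
      _ < ε := hclose

/-- Trajectories that leave the hollow are stable under perturbations. -/
theorem Exits.stable (hΩ : IsOpen Ω)
    (hopen : ∀ z ∈ openSegment ℝ P Q, ∃ ν, IsFlatBoundaryPoint Ω z ν ∧
      ∀ᶠ y in 𝓝 z, inner ℝ (y - z) ν = 0 → y ∈ openSegment ℝ P Q)
    (hwall : ∀ z ν, IsFlatBoundaryPoint Ω z ν → z ∉ openSegment ℝ P Q →
      ∀ᶠ y in 𝓝 z, y ∉ openSegment ℝ P Q)
    (h : Exits Ω P Q p v w) {ν₀ : ℂ} (h₀ : IsFlatBoundaryPoint Ω p ν₀)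
    (hp : Tendsto pX l (𝓝 p)) (hv : Tendsto vX l (𝓝 v))
    (hpν : ∀ᶠ x in l, inner ℝ (pX x - p) ν₀ = 0) :
    ∃ wX : X → ℂ, Tendsto wX l (𝓝 w) ∧ ∀ᶠ x in l, Exits Ω P Q (pX x) (vX x) (wX x) := by
  induction h generalizing pX vX ν₀ with
  | @leave p v t ht hs hl =>
    obtain ⟨ν, hν, hev⟩ := hopen _ hl
    obtain ⟨T, hT, H⟩ := flight_stable hΩ h₀ ht hs hν hp hv hpν
    refine ⟨vX, hv, ?_⟩
    filter_upwards [H, (hp.add (hT.smul hv)).eventually hev] with x ⟨h1, h2, h3⟩ h4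
    exact .leave h1 h2 (h4 h3)
  | @bounce p v w ν t ht hs hl hν h ih =>
    obtain ⟨T, hT, H⟩ := flight_stable hΩ h₀ ht hs hν hp hv hpν
    have hp' := hp.add (hT.smul hv)
    have hv' : Tendsto (fun x => reflect (vX x) ν) l (𝓝 (reflect v ν)) := by
      have : Continuous fun u => reflect u ν := by unfold reflect; fun_prop
      exact (this.tendsto v).comp hv
    obtain ⟨wX, hw, Hw⟩ := ih hν hp' hv' (H.mono fun x hx => hx.2.2)
    refine ⟨wX, hw, ?_⟩
    filter_upwards [H, Hw, hp'.eventually hν.eventually_flat, hp'.eventually (hwall _ _ hν hl)]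
      with x ⟨h1, h2, h3⟩ h4 h5 h6
    exact .bounce h1 h2 h6 (h5 h3) h4

end Trajectories

section Geometry

/-! ### The geometry of the notched angle -/

theorem inner_eq_re_add_im (z w : ℂ) : inner ℝ z w = z.re * w.re + z.im * w.im := by
  rw [Complex.inner]; simp [Complex.mul_re]; ring

/-- The notched angle in terms of the half-width `a` of the opening and the ratio `q`. -/
def hollow (a q : ℝ) : Set ℂ :=
  {z | -1 < z.im ∧ ∃ n : ℕ, -q ^ n ≤ z.im ∧ z.im < -q ^ (n + 1) ∧ |z.re| < a * q ^ n}

variable {a q : ℝ}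

theorem mem_opening_iff (ha : 0 < a) {z : ℂ} :
    z ∈ openSegment ℝ (⟨-a, -1⟩ : ℂ) ⟨a, -1⟩ ↔ z.im = -1 ∧ |z.re| < a := by
  rw [openSegment_eq_image', mem_image]
  constructor
  · rintro ⟨θ, hθ, rfl⟩
    refine ⟨by simp, ?_⟩
    rw [abs_lt]
    constructor <;> simp <;> nlinarith [hθ.1, hθ.2]
  · rintro ⟨h1, h2⟩
    rw [abs_lt] at h2
    refine ⟨(z.re + a) / (2 * a), ⟨div_pos (by linarith) (by linarith),
      (div_lt_one (by linarith)).2 (by linarith)⟩, ?_⟩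
    apply Complex.ext
    · rw [Complex.add_re, Complex.smul_re, Complex.sub_re, smul_eq_mul]
      field_simp; ring
    · rw [Complex.add_im, Complex.smul_im, Complex.sub_im, smul_eq_mul, h1]
      ring

theorem opening_disjoint_hollow (ha : 0 < a) :
    ∀ z ∈ openSegment ℝ (⟨-a, -1⟩ : ℂ) ⟨a, -1⟩, z ∉ hollow a q := by
  intro z hz h
  have := h.1
  rw [((mem_opening_iff ha).1 hz).1] at this
  exact lt_irrefl _ this

theorem mem_hollow_iff_of_level (hq₀ : 0 < q) (hq₁ : q < 1) {z : ℂ} {k : ℕ} (h1 : -1 < z.im)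
    (h2 : -q ^ k ≤ z.im) (h3 : z.im < -q ^ (k + 1)) : z ∈ hollow a q ↔ |z.re| < a * q ^ k := by
  constructor
  · rintro ⟨-, n, hn, hn', h⟩
    have e1 : q ^ (n + 1) < q ^ k := by linarith
    have e2 : q ^ (k + 1) < q ^ n := by linarith
    rw [pow_lt_pow_iff_right_of_lt_one₀ hq₀ hq₁] at e1 e2
    obtain rfl : n = k := by omega
    exact h
  · exact fun h => ⟨h1, k, h2, h3, h⟩

theorem isOpen_hollow (hq₀ : 0 < q) (hq₁ : q < 1) (ha : 0 < a) : IsOpen (hollow a q) := by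
  -- The second family covers the horizontal lines on which two levels meet; there only the narrower
  -- cross-section is interior.
  have key : hollow a q =
      (⋃ n : ℕ, {z : ℂ | -q ^ n < z.im ∧ z.im < -q ^ (n + 1) ∧ |z.re| < a * q ^ n}) ∪
      ⋃ n : ℕ, {z : ℂ | -q ^ n < z.im ∧ z.im < -q ^ (n + 2) ∧ |z.re| < a * q ^ (n + 1)} := by
    ext z
    simp only [mem_union, mem_iUnion, mem_ofPred_eq]
    constructor
    · rintro ⟨h1, n, h2, h3, h4⟩
      rcases h2.lt_or_eq with h2 | h2
      · exact .inl ⟨n, h2, h3, h4⟩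
      · obtain _ | n := n
        · simp at h2; linarith
        · refine .inr ⟨n, ?_, h3, h4⟩
          rw [← h2]
          have := (pow_lt_pow_iff_right_of_lt_one₀ hq₀ hq₁).2 (Nat.lt_succ_self n)
          simpa using this
    · rintro (⟨n, h1, h2, h3⟩ | ⟨n, h1, h2, h3⟩)
      · exact ⟨by linarith [pow_le_one₀ (n := n) hq₀.le hq₁.le], n, h1.le, h2, h3⟩
      · refine ⟨by linarith [pow_le_one₀ (n := n) hq₀.le hq₁.le], ?_⟩
        have := (pow_lt_pow_iff_right_of_lt_one₀ hq₀ hq₁).2 (Nat.lt_succ_self n)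
        rcases lt_or_ge z.im (-q ^ (n + 1)) with h | h
        · exact ⟨n, h1.le, h, h3.trans (by gcongr)⟩
        · exact ⟨n + 1, h, h2, h3⟩
  rw [key]
  refine (isOpen_iUnion fun n => ?_).union (isOpen_iUnion fun n => ?_) <;>
  exact (isOpen_lt (by fun_prop) (by fun_prop)).and
    ((isOpen_lt (by fun_prop) (by fun_prop)).and (isOpen_lt (by fun_prop) (by fun_prop)))

theorem isFlatBoundaryPoint_of_eventually {Ω : Set ℂ} {p ν : ℂ} (hν : ‖ν‖ = 1)
    (h : ∀ᶠ z in 𝓝 p, (z ∈ Ω ↔ inner ℝ (z - p) ν < 0)) : IsFlatBoundaryPoint Ω p ν := by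
  obtain ⟨r, hr, h⟩ := Metric.eventually_nhds_iff_ball.1 h
  exact ⟨hν, r, hr, h⟩

theorem isFlatBoundaryPoint_opening (hq₀ : 0 < q) (hq₁ : q < 1) {p : ℂ} (h1 : p.im = -1)
    (h2 : |p.re| < a) :
    IsFlatBoundaryPoint (hollow a q) p (-Complex.I) := by
  refine isFlatBoundaryPoint_of_eventually (by simp) ?_
  have e1 : ∀ᶠ z : ℂ in 𝓝 p, |z.re| < a := (isOpen_lt (by fun_prop) (by fun_prop)).mem_nhds h2
  have e2 : ∀ᶠ z : ℂ in 𝓝 p, z.im < -q :=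
    (isOpen_lt (by fun_prop) (by fun_prop)).mem_nhds (by simp [h1, hq₁])
  filter_upwards [e1, e2] with z h3 h4
  rw [inner_eq_re_add_im]
  simp only [Complex.sub_re, Complex.neg_re, Complex.I_re, Complex.sub_im, Complex.neg_im,
    Complex.I_im, h1]
  constructor
  · intro h; linarith [h.1]
  · intro h
    have h5 : -1 < z.im := by linarith
    rw [mem_hollow_iff_of_level hq₀ hq₁ (k := 0) h5] <;> simp only [pow_zero, zero_add, pow_one,
      mul_one] <;> linarith

theorem isFlatBoundaryPoint_wall (hq₀ : 0 < q) (hq₁ : q < 1) (ha : 0 < a)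
    {p : ℂ} {k : ℕ} {ε : ℝ} (hε : |ε| = 1) (h1 : p.re = ε * (a * q ^ k))
    (h2 : -q ^ k < p.im) (h3 : p.im < -q ^ (k + 1)) :
    IsFlatBoundaryPoint (hollow a q) p (ε : ℂ) := by
  refine isFlatBoundaryPoint_of_eventually (by simp [hε]) ?_
  have hw : 0 < a * q ^ k := by positivity
  have e1 : ∀ᶠ z : ℂ in 𝓝 p, 0 < ε * z.re := by
    refine (isOpen_lt (by fun_prop) (by fun_prop)).mem_nhds ?_
    rw [mem_ofPred_eq, h1, ← mul_assoc, ← abs_mul_abs_self ε, hε]; linarith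
  have e2 : ∀ᶠ z : ℂ in 𝓝 p, z.im < -q ^ (k + 1) :=
    (isOpen_lt (by fun_prop) (by fun_prop)).mem_nhds h3
  have e3 : ∀ᶠ z : ℂ in 𝓝 p, -q ^ k < z.im :=
    (isOpen_lt (by fun_prop) (by fun_prop)).mem_nhds h2
  filter_upwards [e1, e2, e3] with z h4 h5 h6
  rw [mem_hollow_iff_of_level hq₀ hq₁ (k := k)
    (by linarith [pow_le_one₀ (n := k) hq₀.le hq₁.le]) h6.le h5, inner_eq_re_add_im]
  simp only [Complex.sub_re, Complex.ofReal_re, Complex.ofReal_im, mul_zero, add_zero, h1]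
  rcases eq_or_eq_neg_of_abs_eq hε with rfl | rfl
  · rw [abs_of_pos (by linarith)]; constructor <;> intro <;> linarith
  · rw [abs_of_neg (by linarith)]; constructor <;> intro <;> linarith

theorem isFlatBoundaryPoint_ceiling (hq₀ : 0 < q) (hq₁ : q < 1) {p : ℂ} {k : ℕ}
    (h1 : p.im = -q ^ (k + 1)) (h2 : a * q ^ (k + 1) < |p.re|) (h3 : |p.re| < a * q ^ k) :
    IsFlatBoundaryPoint (hollow a q) p Complex.I := by
  refine isFlatBoundaryPoint_of_eventually (by simp) ?_
  have m1 := (pow_lt_pow_iff_right_of_lt_one₀ hq₀ hq₁).2 (Nat.lt_succ_self k)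
  have m2 := (pow_lt_pow_iff_right_of_lt_one₀ hq₀ hq₁).2 (Nat.lt_succ_self (k + 1))
  simp only [Nat.succ_eq_add_one] at m1 m2
  have e1 : ∀ᶠ z : ℂ in 𝓝 p, a * q ^ (k + 1) < |z.re| :=
    (isOpen_lt (by fun_prop) (by fun_prop)).mem_nhds h2
  have e2 : ∀ᶠ z : ℂ in 𝓝 p, |z.re| < a * q ^ k :=
    (isOpen_lt (by fun_prop) (by fun_prop)).mem_nhds h3
  have e3 : ∀ᶠ z : ℂ in 𝓝 p, -q ^ k < z.im :=
    (isOpen_lt (by fun_prop) (by fun_prop)).mem_nhds (by simp [h1, m1])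
  have e4 : ∀ᶠ z : ℂ in 𝓝 p, z.im < -q ^ (k + 1 + 1) :=
    (isOpen_lt (by fun_prop) (by fun_prop)).mem_nhds (by simp [h1, m2])
  filter_upwards [e1, e2, e3, e4] with z h4 h5 h6 h7
  have h8 : -1 < z.im := by linarith [pow_le_one₀ (n := k) hq₀.le hq₁.le]
  rw [inner_eq_re_add_im]
  simp only [Complex.sub_re, Complex.I_re, Complex.sub_im, Complex.I_im, h1]
  rcases lt_or_ge z.im (-q ^ (k + 1)) with h | h
  · rw [mem_hollow_iff_of_level hq₀ hq₁ h8 h6.le h]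
    constructor <;> intro <;> linarith
  · rw [mem_hollow_iff_of_level hq₀ hq₁ h8 h h7]
    constructor <;> intro <;> linarith

theorem opening_flat (hq₀ : 0 < q) (hq₁ : q < 1) (ha : 0 < a) :
    ∀ z ∈ openSegment ℝ (⟨-a, -1⟩ : ℂ) ⟨a, -1⟩, ∃ ν, IsFlatBoundaryPoint (hollow a q) z ν ∧
      ∀ᶠ y in 𝓝 z, inner ℝ (y - z) ν = 0 → y ∈ openSegment ℝ (⟨-a, -1⟩ : ℂ) ⟨a, -1⟩ := by
  intro z hz
  obtain ⟨h1, h2⟩ := (mem_opening_iff ha).1 hz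
  refine ⟨-Complex.I, isFlatBoundaryPoint_opening hq₀ hq₁ h1 h2, ?_⟩
  have e1 : ∀ᶠ y : ℂ in 𝓝 z, |y.re| < a := (isOpen_lt (by fun_prop) (by fun_prop)).mem_nhds h2
  filter_upwards [e1] with y hy h
  rw [inner_eq_re_add_im] at h
  simp [h1] at h
  exact (mem_opening_iff ha).2 ⟨by linarith, hy⟩

theorem wall_away_from_opening (hq₀ : 0 < q) (hq₁ : q < 1) (ha : 0 < a) :
    ∀ z ν, IsFlatBoundaryPoint (hollow a q) z ν → z ∉ openSegment ℝ (⟨-a, -1⟩ : ℂ) ⟨a, -1⟩ →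
      ∀ᶠ y in 𝓝 z, y ∉ openSegment ℝ (⟨-a, -1⟩ : ℂ) ⟨a, -1⟩ := by
  intro z ν hν hz
  simp only [mem_opening_iff ha, not_and, not_lt] at hz ⊢
  by_cases h1 : z.im = -1
  · rcases (hz h1).lt_or_eq with h2 | h2
    · have e1 : ∀ᶠ y : ℂ in 𝓝 z, a < |y.re| :=
        (isOpen_lt (by fun_prop) (by fun_prop)).mem_nhds h2
      exact e1.mono fun y hy _ => hy.le
    · exfalso
      -- At an endpoint of the opening no horizontal or vertical direction enters the hollow, so a
      -- normal would be orthogonal to both axes.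
      have key : ∀ d : ℂ, (d.im = 0 ∨ d.re = 0) → 0 ≤ inner ℝ d ν := by
        intro d hd
        by_contra! hneg
        obtain ⟨s, hs, hs0⟩ := ((hν.eventually_iff d).and self_mem_nhdsWithin).exists
        obtain ⟨hm, n, h3, h4, h5⟩ := hs.2 hneg
        rcases hd with hd | hd
        · simp [hd, h1] at hm
        · simp only [Complex.add_re, Complex.real_smul, Complex.mul_re, Complex.ofReal_re,
            Complex.ofReal_im, hd, mul_zero, zero_mul, sub_zero, add_zero, ← h2] at h5
          nlinarith [pow_le_one₀ (n := n) hq₀.le hq₁.le]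
      have k1 := key ν.re (by simp)
      have k2 := key (-ν.re) (by simp)
      have k3 := key (ν.im * Complex.I) (by simp)
      have k4 := key (-(ν.im * Complex.I)) (by simp)
      rw [inner_neg_left] at k2 k4
      have := hν.1
      rw [inner_eq_re_add_im] at k1 k2 k3 k4
      simp at k1 k2 k3 k4
      have e1 : ν.re = 0 := by nlinarith
      have e2 : ν.im = 0 := by nlinarith
      have : ν = 0 := Complex.ext e1 e2
      simp [this] at *
  · have e1 : ∀ᶠ y : ℂ in 𝓝 z, y.im ≠ -1 :=
      (isOpen_ne_fun (by fun_prop) (by fun_prop)).mem_nhds h1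
    exact e1.mono fun y hy h => absurd h hy

end Geometry

section Motion

/-! ### The motion inside the notched angle

A point is written as `(a y, -r)`, and the state of a particle is the pair `(τ, y)`, where `τ` is
the signed slope of the trajectory in the coordinates `y` and `r`. -/

/-- The motion across a rectangle of half-width `w` and height `Δ` with reflecting lateral sides,
for particles that are reflected at most once. -/
def levelMap (w Δ : ℝ) (x : ℝ × ℝ) : ℝ × ℝ :=
  if |x.2 + x.1 * Δ| < w then (x.1, x.2 + x.1 * Δ)
  else if 0 < x.2 + x.1 * Δ then (-x.1, 2 * w - (x.2 + x.1 * Δ))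
  else (-x.1, -(2 * w) - (x.2 + x.1 * Δ))

/-- The motion across the `k`-th level of the notched angle, in either direction. -/
def step (q : ℝ) (k : ℕ) : ℝ × ℝ → ℝ × ℝ := levelMap (q ^ k) (q ^ k - q ^ (k + 1))

/-- The motion upwards from the opening to the bottom of the `n`-th level. -/
def up (q : ℝ) : ℕ → ℝ × ℝ → ℝ × ℝ
  | 0, x => x
  | n + 1, x => step q n (up q n x)

/-- The motion downwards from the bottom of the `n`-th level to the opening. -/
def down (q : ℝ) : ℕ → ℝ × ℝ → ℝ × ℝ
  | 0, x => x
  | n + 1, x => down q n (step q n x)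

/-- On its way down the particle does not meet a vertex. -/
def AvoidsDown (q : ℝ) : ℕ → ℝ × ℝ → Prop
  | 0, _ => True
  | n + 1, x => |(step q n x).2| ≠ q ^ n ∧ AvoidsDown q n (step q n x)

/-- The point with normalized coordinates `y` and `r`. -/
def pos (a y r : ℝ) : ℂ := ⟨a * y, -r⟩

/-- The velocity with slope `τ` and vertical component `e * c`. -/
def vel (a c e τ : ℝ) : ℂ := ⟨a * (c * τ), e * c⟩

variable {a q c e τ : ℝ} {k : ℕ}

theorem pos_add_smul_vel (a c e τ y r s : ℝ) :
    pos a y r + s • vel a c e τ = pos a (y + s * c * τ) (r - s * c * e) := by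
  apply Complex.ext
  · simp [pos, vel]; ring
  · simp [pos, vel]; ring

theorem reflect_vel_wall {ε : ℝ} (hε : |ε| = 1) :
    reflect (vel a c e τ) (ε : ℂ) = vel a c e (-τ) := by
  have h : ε * ε = 1 := by rw [← abs_mul_abs_self, hε, one_mul]
  apply Complex.ext
  · simp [reflect, vel]
    linear_combination (-(2 * (a * (c * τ)))) * h
  · simp [reflect, vel]

theorem reflect_vel_ceiling : reflect (vel a c e τ) Complex.I = vel a c (-e) τ := by
  apply Complex.ext
  · simp [reflect, vel]
  · simp [reflect, vel]; ring

theorem abs_step_fst (x : ℝ × ℝ) : |(step q k x).1| = |x.1| := by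
  unfold step levelMap
  split_ifs <;> simp

theorem abs_up_fst (n : ℕ) (x : ℝ × ℝ) : |(up q n x).1| = |x.1| := by
  induction n with
  | zero => rfl
  | succ n ih => rw [up, abs_step_fst, ih]

/-- The bound on |τ| (1 - q) says that the displacement across a level is smaller than its full
width, so a single reflection suffices. -/
theorem abs_step_snd_le (hq₀ : 0 < q) (hq₁ : q < 1) {x : ℝ × ℝ} (hx : |x.2| < q ^ k)
    (hτ : |x.1| * (1 - q) < 2) : |(step q k x).2| ≤ q ^ k := by
  have hw : 0 < q ^ k := by positivity
  have hΔ : |x.1 * (q ^ k - q ^ (k + 1))| < 2 * q ^ k := by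
    have : x.1 * (q ^ k - q ^ (k + 1)) = x.1 * (1 - q) * q ^ k := by ring
    rw [this, abs_mul, abs_of_pos hw]
    refine mul_lt_mul_of_pos_right ?_ hw
    rw [abs_mul]
    rwa [abs_of_pos (sub_pos.2 hq₁)]
  rw [abs_lt] at hx hΔ
  unfold step levelMap
  split_ifs with h1 h2
  · exact h1.le
  · rw [abs_lt, not_and_or, not_lt, not_lt] at h1
    rw [abs_le]
    constructor
    · dsimp only; linarith
    · dsimp only; rcases h1 with h1 | h1 <;> linarith
  · rw [abs_lt, not_and_or, not_lt, not_lt] at h1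
    rw [abs_le]
    constructor
    · dsimp only; rcases h1 with h1 | h1 <;> linarith
    · dsimp only; linarith

/-! ### From the maps on states to genuine trajectories -/

/-- A particle which reaches `p` with velocity `v` finally leaves with velocity `w`. -/
def Arrives (Ω : Set ℂ) (P Q p v w : ℂ) : Prop :=
  ∀ z : ℂ, ∀ t : ℝ, 0 < t → (∀ s ∈ Ioo 0 t, z + s • v ∈ Ω) → z + t • v = p → Exits Ω P Q z v w

/-- At an interior point the incoming flight is merely prolonged. With the two lemmas that follow,
this treats uniformly the three ways in which the crossing of a level can end. -/
theorem Exits.arrives {Ω : Set ℂ} {P Q p v w : ℂ} (h : Exits Ω P Q p v w) (hp : p ∈ Ω) :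
    Arrives Ω P Q p v w := by
  rintro z t ht hs rfl
  refine h.extend ht fun s hs' => ?_
  rcases hs'.2.lt_or_eq with h1 | rfl
  · exact hs s ⟨hs'.1, h1⟩
  · exact hp

theorem arrives_opening {Ω : Set ℂ} {P Q p v : ℂ} (hp : p ∈ openSegment ℝ P Q) :
    Arrives Ω P Q p v v := by
  rintro z t ht hs rfl
  exact .leave ht hs hp

theorem Exits.arrives_wall {Ω : Set ℂ} {P Q p v w ν : ℂ} (h : Exits Ω P Q p (reflect v ν) w)
    (hp : p ∉ openSegment ℝ P Q) (hν : IsFlatBoundaryPoint Ω p ν) : Arrives Ω P Q p v w := by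
  rintro z t ht hs rfl
  exact .bounce ht hs hp hν h

theorem pos_mem_hollow (ha : 0 < a) (hq₀ : 0 < q) (hq₁ : q < 1) {y r : ℝ} (h1 : r < 1)
    (h2 : r ≤ q ^ k) (h3 : q ^ (k + 1) < r) (hy : |y| < q ^ k) : pos a y r ∈ hollow a q := by
  rw [mem_hollow_iff_of_level hq₀ hq₁ (k := k)]
  · simp only [pos, abs_mul, abs_of_pos ha]
    gcongr
  all_goals simp only [pos]; linarith

/-- The motion across one level of the notched angle. -/
theorem exits_of_arrives (ha : 0 < a) (hq₀ : 0 < q) (hq₁ : q < 1) (hc : 0 < c) {x : ℝ × ℝ}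
    {r₀ r₁ : ℝ} {w : ℂ}
    (hdir : e = 1 ∧ r₀ = q ^ k ∧ r₁ = q ^ (k + 1) ∨ e = -1 ∧ r₀ = q ^ (k + 1) ∧ r₁ = q ^ k)
    (hx : |x.2| < q ^ k) (hx' : |(step q k x).2| < q ^ k)
    (h : Arrives (hollow a q) ⟨-a, -1⟩ ⟨a, -1⟩ (pos a (step q k x).2 r₁)
      (vel a c e (step q k x).1) w) :
    Exits (hollow a q) ⟨-a, -1⟩ ⟨a, -1⟩ (pos a x.2 r₀) (vel a c e x.1) w := by
  obtain ⟨τ, y⟩ := x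
  dsimp only at hx ⊢
  have hw : 0 < q ^ k := by positivity
  have hw1 : q ^ k ≤ 1 := pow_le_one₀ hq₀.le hq₁.le
  set Δ := q ^ k - q ^ (k + 1) with hΔdef
  have hΔ : 0 < Δ := by rw [hΔdef, pow_succ]; nlinarith
  have hT : 0 < Δ / c := div_pos hΔ hc
  have hTc : Δ / c * c = Δ := div_mul_cancel₀ _ hc.ne'
  have hr : ∀ s : ℝ, 0 < s → s < Δ / c → q ^ (k + 1) < r₀ - s * c * e ∧ r₀ - s * c * e < q ^ k := by
    intro s hs0 hs1
    have h1 : 0 < s * c := by positivity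
    have h2 : s * c < Δ := by rw [← hTc]; gcongr
    rcases hdir with ⟨rfl, rfl, -⟩ | ⟨rfl, rfl, -⟩ <;> constructor <;> linarith
  have hr₁ : r₀ - Δ * e = r₁ := by
    rcases hdir with ⟨rfl, rfl, rfl⟩ | ⟨rfl, rfl, rfl⟩ <;> rw [hΔdef] <;> ring
  have hmem : ∀ s y' : ℝ, 0 < s → s < Δ / c → |y'| < q ^ k →
      pos a y' (r₀ - s * c * e) ∈ hollow a q := by
    intro s y' h1 h2 h3
    obtain ⟨h4, h5⟩ := hr s h1 h2
    exact pos_mem_hollow ha hq₀ hq₁ (by linarith) h5.le h4 h3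
  have hconv : ∀ {y₀ y₁ θ : ℝ}, |y₀| < q ^ k → |y₁| ≤ q ^ k → 0 ≤ θ → θ < 1 →
      |y₀ + θ * (y₁ - y₀)| < q ^ k := by
    intro y₀ y₁ θ h0 h1 h2 h3
    rw [abs_lt] at h0 ⊢
    rw [abs_le] at h1
    constructor <;> nlinarith
  set u := y + τ * Δ with hu
  have hfree : |u| < q ^ k → Exits (hollow a q) ⟨-a, -1⟩ ⟨a, -1⟩ (pos a y r₀) (vel a c e τ) w := by
    intro h1
    have hst : step q k (τ, y) = (τ, u) := by
      unfold step levelMap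
      rw [if_pos h1]
    rw [hst] at h
    refine h _ (Δ / c) hT (fun s hs => ?_) ?_
    · rw [pos_add_smul_vel]
      refine hmem s _ hs.1 hs.2 ?_
      have := hconv hx h1.le (div_pos hs.1 hT).le ((div_lt_one hT).2 hs.2)
      convert this using 2
      rw [hu]; field_simp; ring
    · rw [pos_add_smul_vel, hTc, hr₁, hu, mul_comm Δ]
  have hbounce : ∀ ε : ℝ, |ε| = 1 → q ^ k < ε * u → step q k (τ, y) = (-τ, ε * (2 * q ^ k) - u) →
      Exits (hollow a q) ⟨-a, -1⟩ ⟨a, -1⟩ (pos a y r₀) (vel a c e τ) w := by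
    intro ε hε h1 hst
    have hεε : ε * ε = 1 := by rw [← abs_mul_abs_self, hε, one_mul]
    have hεy : |ε * y| < q ^ k := by rwa [abs_mul, hε, one_mul]
    rw [hst] at h hx'
    have hετ : 0 < ε * τ := by
      by_contra! hneg
      have : ε * u = ε * y + ε * τ * Δ := by rw [hu]; ring
      have := (abs_lt.1 hεy).2
      nlinarith
    -- The moment at which the particle hits the wall on the side ε; the remaining time `Δ / c - t₁`
    -- is flown with the opposite slope.
    set t₁ := (q ^ k - ε * y) / (c * (ε * τ)) with ht₁
    have hcτ : 0 < c * (ε * τ) := by positivity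
    have ht₁0 : 0 < t₁ := div_pos (by linarith [(abs_lt.1 hεy).2]) hcτ
    have ht₁c : t₁ * c * (ε * τ) = q ^ k - ε * y := by
      rw [mul_assoc]; exact div_mul_cancel₀ _ hcτ.ne'
    have ht₁T : t₁ < Δ / c := by
      rw [lt_div_iff₀ hc]
      have : q ^ k - ε * y < ε * τ * Δ := by
        have : ε * u = ε * y + ε * τ * Δ := by rw [hu]; ring
        linarith
      rw [← ht₁c] at this
      exact lt_of_mul_lt_mul_left (by linarith) hετ.le
    have hy₁ : y + t₁ * c * τ = ε * q ^ k := by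
      have : ε * (y + t₁ * c * τ) = q ^ k := by linear_combination ht₁c
      rw [← this, ← mul_assoc, hεε, one_mul]
    have hr1 := hr t₁ ht₁0 ht₁T
    have habs : |ε * q ^ k| = q ^ k := by rw [abs_mul, hε, one_mul, abs_of_pos hw]
    have hpt : pos a y r₀ + t₁ • vel a c e τ = pos a (ε * q ^ k) (r₀ - t₁ * c * e) := by
      rw [pos_add_smul_vel, hy₁]
    refine Exits.bounce (t := t₁) (ν := (ε : ℂ)) ht₁0 (fun s hs => ?_) ?_ ?_ ?_
    · rw [pos_add_smul_vel]
      refine hmem s _ hs.1 (hs.2.trans ht₁T) ?_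
      have := hconv hx habs.le (div_pos hs.1 ht₁0).le ((div_lt_one ht₁0).2 hs.2)
      convert this using 2
      rw [← hy₁]; field_simp; ring
    · rw [hpt, mem_opening_iff ha]
      intro h'
      have : (pos a (ε * q ^ k) (r₀ - t₁ * c * e)).im = -1 := h'.1
      simp only [pos] at this
      linarith
    · rw [hpt]
      refine isFlatBoundaryPoint_wall hq₀ hq₁ ha (k := k) hε ?_ ?_ ?_ <;> simp only [pos]
      · ring
      · linarith
      · linarith
    · rw [hpt, reflect_vel_wall hε]
      have ht₂ : 0 < Δ / c - t₁ := by linarith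
      refine h _ (Δ / c - t₁) ht₂ (fun s hs => ?_) ?_
      · rw [pos_add_smul_vel]
        have hrw : r₀ - t₁ * c * e - s * c * e = r₀ - (t₁ + s) * c * e := by ring
        rw [hrw]
        refine hmem (t₁ + s) _ (by linarith [hs.1]) (by linarith [hs.2]) ?_
        have hθ : 0 < 1 - s / (Δ / c - t₁) := by
          rw [sub_pos, div_lt_one ht₂]; exact hs.2
        have := hconv hx' habs.le hθ.le (by linarith [div_pos hs.1 ht₂])
        convert this using 2
        have e1 : ε * (2 * q ^ k) - u = ε * q ^ k - (Δ / c - t₁) * c * τ := by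
          rw [hu]
          linear_combination τ * hTc - hy₁
        dsimp only
        rw [e1]
        have hne := ht₂.ne'
        clear_value t₁
        generalize Δ / c - t₁ = D at hne ⊢
        field_simp
        ring
      · rw [pos_add_smul_vel]
        congr 1
        · dsimp only
          rw [hu]
          linear_combination hy₁ - τ * hTc
        · rw [← hr₁]
          linear_combination (-e) * hTc
  rcases lt_or_ge |u| (q ^ k) with h1 | h1
  · exact hfree h1
  · rcases lt_or_ge 0 u with h2 | h2
    · have hst : step q k (τ, y) = (-τ, 1 * (2 * q ^ k) - u) := by
        unfold step levelMap
        rw [if_neg (not_lt.2 h1), if_pos h2, one_mul]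
      refine hbounce 1 (by simp) ?_ hst
      rw [hst, abs_lt] at hx'
      dsimp only at hx'
      linarith
    · have hst : step q k (τ, y) = (-τ, (-1) * (2 * q ^ k) - u) := by
        unfold step levelMap
        rw [if_neg (not_lt.2 h1), if_neg (not_lt.2 h2), neg_one_mul]
      refine hbounce (-1) (by simp) ?_ hst
      rw [hst, abs_lt] at hx'
      dsimp only at hx'
      linarith

/-- A falling particle enters ever wider levels, so it meets no horizontal segment and each crossing
leads into the next. -/
theorem exits_down (ha : 0 < a) (hq₀ : 0 < q) (hq₁ : q < 1) (hc : 0 < c) {n : ℕ} {x : ℝ × ℝ}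
    (hx : |x.2| < q ^ n) (hτ : |x.1| * (1 - q) < 2) (hgen : AvoidsDown q (n + 1) x) :
    Exits (hollow a q) ⟨-a, -1⟩ ⟨a, -1⟩ (pos a x.2 (q ^ (n + 1))) (vel a c (-1) x.1)
      (vel a c (-1) (down q (n + 1) x).1) := by
  induction n generalizing x with
  | zero =>
    have hx' := lt_of_le_of_ne (abs_step_snd_le hq₀ hq₁ hx hτ) hgen.1
    refine exits_of_arrives ha hq₀ hq₁ hc (k := 0) (.inr ⟨rfl, rfl, rfl⟩) hx hx' ?_
    refine arrives_opening ((mem_opening_iff ha).2 ⟨by simp [pos], ?_⟩)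
    simp only [pos, abs_mul, abs_of_pos ha]
    rw [pow_zero] at hx'
    nlinarith
  | succ n ih =>
    have hx' := lt_of_le_of_ne (abs_step_snd_le hq₀ hq₁ hx hτ) hgen.1
    refine exits_of_arrives ha hq₀ hq₁ hc (k := n + 1) (.inr ⟨rfl, rfl, rfl⟩) hx hx' ?_
    have hlt : q ^ (n + 1) < q ^ n := pow_lt_pow_right_of_lt_one₀ hq₀ hq₁ n.lt_succ_self
    have hlt' : q ^ (n + 2) < q ^ (n + 1) := pow_lt_pow_right_of_lt_one₀ hq₀ hq₁ (by omega)
    refine (ih (hx'.trans hlt) (by rwa [abs_step_fst]) hgen.2).arrives ?_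
    exact pos_mem_hollow ha hq₀ hq₁ (pow_lt_one₀ hq₀.le hq₁ (by omega)) le_rfl hlt' hx'

/-- A particle which first meets a ceiling in the `n`-th level leaves the hollow, and its final
slope is the one computed by `up` and `down`. -/
theorem exits_up (ha : 0 < a) (hq₀ : 0 < q) (hq₁ : q < 1) (hc : 0 < c) {n : ℕ} {x : ℝ × ℝ}
    (hτ : |x.1| * (1 - q) < 2) (hx : ∀ k ≤ n, |(up q k x).2| < q ^ k)
    (hturn : q ^ (n + 1) < |(up q (n + 1) x).2|) (hgen : |(up q (n + 1) x).2| ≠ q ^ n)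
    (hgen' : AvoidsDown q (n + 1) (up q (n + 1) x)) :
    Exits (hollow a q) ⟨-a, -1⟩ ⟨a, -1⟩ (pos a x.2 1) (vel a c 1 x.1)
      (vel a c (-1) (down q (n + 1) (up q (n + 1) x)).1) := by
  -- Legs can only be prepended, so the induction starts in the level of the turn, `i = 0`, and goes
  -- back to the opening, `i = n`.
  have key : ∀ i ≤ n, Exits (hollow a q) ⟨-a, -1⟩ ⟨a, -1⟩
      (pos a (up q (n - i) x).2 (q ^ (n - i))) (vel a c 1 (up q (n - i) x).1)
      (vel a c (-1) (down q (n + 1) (up q (n + 1) x)).1) := by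
    intro i
    induction i with
    | zero =>
      intro _
      have hx' : |(up q (n + 1) x).2| < q ^ n :=
        lt_of_le_of_ne (abs_step_snd_le hq₀ hq₁ (hx n le_rfl) (by rwa [abs_up_fst])) hgen
      refine exits_of_arrives ha hq₀ hq₁ hc (k := n) (.inl ⟨rfl, rfl, rfl⟩) (hx n le_rfl) hx' ?_
      refine Exits.arrives_wall (ν := Complex.I) ?_ ?_ ?_
      · rw [reflect_vel_ceiling]
        exact exits_down ha hq₀ hq₁ hc hx' (by rwa [abs_step_fst, abs_up_fst]) hgen'
      · intro h'
        have : (pos a (step q n (up q n x)).2 (q ^ (n + 1))).im = -1 :=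
          ((mem_opening_iff ha).1 h').1
        simp only [pos] at this
        linarith [pow_lt_one₀ hq₀.le hq₁ (Nat.add_one_ne_zero n)]
      · refine isFlatBoundaryPoint_ceiling hq₀ hq₁ (k := n) rfl ?_ ?_ <;>
          simp only [pos, abs_mul, abs_of_pos ha]
        · exact mul_lt_mul_of_pos_left hturn ha
        · exact mul_lt_mul_of_pos_left hx' ha
    | succ i ih =>
      intro hi
      have hk : n - i = n - (i + 1) + 1 := by omega
      have ih := ih (by omega)
      have hx1 := hx (n - i) (by omega)
      rw [hk] at ih hx1
      set k := n - (i + 1)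
      have hlt : q ^ (k + 1) < q ^ k := pow_lt_pow_right_of_lt_one₀ hq₀ hq₁ k.lt_succ_self
      have hlt' : q ^ (k + 2) < q ^ (k + 1) := pow_lt_pow_right_of_lt_one₀ hq₀ hq₁ (by omega)
      refine exits_of_arrives ha hq₀ hq₁ hc (k := k) (.inl ⟨rfl, rfl, rfl⟩) (hx k (by omega))
        (hx1.trans hlt) ?_
      exact ih.arrives
        (pos_mem_hollow ha hq₀ hq₁ (pow_lt_one₀ hq₀.le hq₁ (by omega)) le_rfl hlt' hx1)
  have := key n le_rfl
  rwa [Nat.sub_self, pow_zero] at this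

end Motion

section Invariant

/-! ### An adiabatic invariant

The quantity `τ y + τ² r` is preserved by free flights, and a reflection of a rising particle
multiplies it by approximately `(|τ| - 1) / (|τ| + 1)`. -/

/-- The quantity which is conserved along the free flights of a rising particle. -/
def moment (x : ℝ × ℝ) (r : ℝ) : ℝ := x.1 * x.2 + x.1 ^ 2 * r

/-- The quantity which is conserved along the free flights of a falling particle. -/
def dualMoment (x : ℝ × ℝ) (r : ℝ) : ℝ := -(x.1 * x.2) + x.1 ^ 2 * r

/-- The ideal ratio of the heights of consecutive reflections. -/
def bounceRatio (t : ℝ) : ℝ := (t - 1) / (t + 1)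

variable {q : ℝ} {k : ℕ}

theorem bounceRatio_pos {t : ℝ} (ht : 1 < t) : 0 < bounceRatio t :=
  div_pos (by linarith) (by linarith)

theorem bounceRatio_lt_one {t : ℝ} (ht : 1 < t) : bounceRatio t < 1 :=
  (div_lt_one (by linarith)).2 (by linarith)

theorem bounceRatio_mono {s t : ℝ} (hs : 1 < s) (hst : s ≤ t) : bounceRatio s ≤ bounceRatio t := by
  unfold bounceRatio
  rw [div_le_div_iff₀ (by linarith) (by linarith)]
  nlinarith

/-- With M = t (t r + w) the hypotheses say q w ≤ r ≤ w, and (t r - w)/(t r + w) increases with r.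
-/
theorem bounceRatio_mul_le {t w M : ℝ} (ht : 0 < t) (hq₀ : 0 < q) (h1 : t * w * (t * q + 1) ≤ M)
    (h2 : M ≤ t * w * (t + 1)) :
    bounceRatio (t * q) * M ≤ M - 2 * t * w ∧ M - 2 * t * w ≤ bounceRatio t * M := by
  have htq : 0 < t * q := mul_pos ht hq₀
  unfold bounceRatio
  constructor
  · rw [div_mul_eq_mul_div, div_le_iff₀ (by linarith)]
    linarith
  · rw [div_mul_eq_mul_div, le_div_iff₀ (by linarith)]
    linarith

/-- The sign ε names the side of the wall that is hit, so that both sides are handled by one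
computation. -/
theorem step_cases (hq₀ : 0 < q) (hq₁ : q < 1) {τ y : ℝ} (hy : |y| < q ^ k) :
    step q k (τ, y) = (τ, y + τ * (q ^ k - q ^ (k + 1))) ∨
    ∃ ε : ℝ, ε * ε = 1 ∧ ε * τ = |τ| ∧ ε * y < q ^ k ∧
      q ^ k ≤ ε * (y + τ * (q ^ k - q ^ (k + 1))) ∧
      step q k (τ, y) = (-τ, ε * (2 * q ^ k) - (y + τ * (q ^ k - q ^ (k + 1)))) := by
  have hΔ : 0 < q ^ k - q ^ (k + 1) :=
    sub_pos.2 (pow_lt_pow_right_of_lt_one₀ hq₀ hq₁ k.lt_succ_self)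
  rw [abs_lt] at hy
  unfold step levelMap
  dsimp only
  split_ifs with h1 h2
  · exact .inl rfl
  · rw [not_lt, abs_of_pos h2] at h1
    have hτ : 0 < τ := pos_of_mul_pos_left (b := q ^ k - q ^ (k + 1)) (by linarith) hΔ.le
    exact .inr ⟨1, by norm_num, by rw [one_mul, abs_of_pos hτ], by linarith, by linarith,
      by rw [one_mul]⟩
  · rw [not_lt, abs_of_nonpos (not_lt.1 h2)] at h1
    have hτ : τ < 0 := by
      by_contra! h
      nlinarith [mul_nonneg h hΔ.le]
    exact .inr ⟨-1, by norm_num, by rw [neg_one_mul, abs_of_neg hτ], by linarith, by linarith,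
      by rw [neg_one_mul]⟩

/-- A reflection at height r by a wall at distance w turns |τ| w + τ² r into -|τ| w + τ² r, and q w
≤ r ≤ w within the level. -/
theorem moment_step (hq₀ : 0 < q) (hq₁ : q < 1) {x : ℝ × ℝ} (hx : |x.2| < q ^ k)
    (hτ : 0 < |x.1|) :
    (step q k x).1 = x.1 ∧ moment (step q k x) (q ^ (k + 1)) = moment x (q ^ k) ∨
    (step q k x).1 = -x.1 ∧
      bounceRatio (|x.1| * q) * moment x (q ^ k) ≤ moment (step q k x) (q ^ (k + 1)) ∧
      moment (step q k x) (q ^ (k + 1)) ≤ bounceRatio |x.1| * moment x (q ^ k) := by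
  obtain ⟨τ, y⟩ := x
  rcases step_cases hq₀ hq₁ (τ := τ) hx with h | ⟨ε, hε, hετ, hεy, hεu, h⟩
  · left
    rw [h]
    exact ⟨rfl, by simp only [moment]; ring⟩
  · right
    rw [h]
    refine ⟨rfl, ?_⟩
    simp only [moment] at *
    have hτε : τ = ε * |τ| := by rw [← hετ, ← mul_assoc, hε, one_mul]
    have key : -τ * (ε * (2 * q ^ k) - (y + τ * (q ^ k - q ^ (k + 1)))) + (-τ) ^ 2 * q ^ (k + 1)
        = τ * y + τ ^ 2 * q ^ k - 2 * |τ| * q ^ k := by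
      rw [← hετ]; ring
    rw [key]
    have e1 : τ * y = |τ| * (ε * y) := by nth_rw 1 [hτε]; ring
    have e2 : τ ^ 2 = |τ| * |τ| := by rw [abs_mul_abs_self, sq]
    have e3 : ε * (y + τ * (q ^ k - q ^ (k + 1))) = ε * y + |τ| * (q ^ k - q ^ (k + 1)) := by
      rw [← hετ]; ring
    rw [e3, pow_succ] at hεu
    refine bounceRatio_mul_le hτ hq₀ ?_ ?_
    · rw [e1, e2]
      nlinarith [mul_le_mul_of_nonneg_left hεu hτ.le]
    · rw [e1, e2]
      nlinarith [mul_lt_mul_of_pos_left hεy hτ]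

/-- This is `moment_step` under time reversal: a falling particle read backwards is a rising one, so
the states before and after exchange their roles. -/
theorem dualMoment_step (hq₀ : 0 < q) (hq₁ : q < 1) {x : ℝ × ℝ} (hx : |x.2| < q ^ k)
    (hτ : 0 < |x.1|) :
    (step q k x).1 = x.1 ∧ dualMoment (step q k x) (q ^ k) = dualMoment x (q ^ (k + 1)) ∨
    (step q k x).1 = -x.1 ∧
      bounceRatio (|x.1| * q) * dualMoment (step q k x) (q ^ k) ≤ dualMoment x (q ^ (k + 1)) ∧
      dualMoment x (q ^ (k + 1)) ≤ bounceRatio |x.1| * dualMoment (step q k x) (q ^ k) := by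
  obtain ⟨τ, y⟩ := x
  rcases step_cases hq₀ hq₁ (τ := τ) hx with h | ⟨ε, hε, hετ, hεy, hεu, h⟩
  · left
    rw [h]
    exact ⟨rfl, by simp only [dualMoment]; ring⟩
  · right
    rw [h]
    refine ⟨rfl, ?_⟩
    simp only [dualMoment] at *
    have hτε : τ = ε * |τ| := by rw [← hετ, ← mul_assoc, hε, one_mul]
    have key : -(τ * y) + τ ^ 2 * q ^ (k + 1) =
        -(-τ * (ε * (2 * q ^ k) - (y + τ * (q ^ k - q ^ (k + 1))))) + (-τ) ^ 2 * q ^ k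
          - 2 * |τ| * q ^ k := by
      rw [← hετ]; ring
    have key' : -(-τ * (ε * (2 * q ^ k) - (y + τ * (q ^ k - q ^ (k + 1))))) + (-τ) ^ 2 * q ^ k =
        -(τ * y) + τ ^ 2 * q ^ (k + 1) + 2 * |τ| * q ^ k := by
      rw [key]; ring
    have e1 : τ * y = |τ| * (ε * y) := by nth_rw 1 [hτε]; ring
    have e2 : τ ^ 2 = |τ| * |τ| := by rw [abs_mul_abs_self, sq]
    have e3 : ε * (y + τ * (q ^ k - q ^ (k + 1))) = ε * y + |τ| * (q ^ k - q ^ (k + 1)) := by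
      rw [← hετ]; ring
    rw [e3, pow_succ] at hεu
    rw [key]
    refine bounceRatio_mul_le hτ hq₀ ?_ ?_
    · rw [key', e1, e2, pow_succ]
      nlinarith [mul_lt_mul_of_pos_left hεy hτ]
    · rw [key', e1, e2, pow_succ]
      nlinarith [mul_le_mul_of_nonneg_left hεu hτ.le]

/-- The number `m` counts the vertical walls met. It governs both the sign of the slope and the size
of the moment, and this link converts a size estimate into a parity. -/
theorem moment_up (hq₀ : 0 < q) (hq₁ : q < 1) {x : ℝ × ℝ} (hτ : 1 < |x.1| * q) (n : ℕ)
    (hx : ∀ k < n, |(up q k x).2| < q ^ k) :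
    ∃ m : ℕ, (up q n x).1 = (-1) ^ m * x.1 ∧
      bounceRatio (|x.1| * q) ^ m * moment x 1 ≤ moment (up q n x) (q ^ n) ∧
      moment (up q n x) (q ^ n) ≤ bounceRatio |x.1| ^ m * moment x 1 := by
  have ht : 1 < |x.1| := by nlinarith [abs_nonneg x.1]
  induction n with
  | zero => exact ⟨0, by simp [up], by simp [up], by simp [up]⟩
  | succ n ih =>
    obtain ⟨m, h1, h2, h3⟩ := ih fun k hk => hx k (by omega)
    have habs := abs_up_fst (q := q) n x
    rcases moment_step hq₀ hq₁ (hx n n.lt_succ_self) (by rw [habs]; linarith) with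
      ⟨h4, h5⟩ | ⟨h4, h5, h6⟩
    · exact ⟨m, by rw [up, h4, h1], by rw [up, h5]; exact h2, by rw [up, h5]; exact h3⟩
    · rw [habs] at h5 h6
      refine ⟨m + 1, by rw [up, h4, h1]; ring, ?_, ?_⟩
      · rw [up, pow_succ', mul_assoc]
        exact (mul_le_mul_of_nonneg_left h2 (bounceRatio_pos hτ).le).trans h5
      · rw [up, pow_succ' (bounceRatio _), mul_assoc]
        exact h6.trans (mul_le_mul_of_nonneg_left h3 (bounceRatio_pos ht).le)

theorem dualMoment_down (hq₀ : 0 < q) (hq₁ : q < 1) {x : ℝ × ℝ} (hτ : 1 < |x.1| * q)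
    (hτ' : |x.1| * (1 - q) < 2) (n : ℕ) (hx : ∀ k < n, |x.2| < q ^ k) :
    ∃ m : ℕ, (down q n x).1 = (-1) ^ m * x.1 ∧
      bounceRatio (|x.1| * q) ^ m * dualMoment (down q n x) 1 ≤ dualMoment x (q ^ n) ∧
      dualMoment x (q ^ n) ≤ bounceRatio |x.1| ^ m * dualMoment (down q n x) 1 := by
  have ht : 1 < |x.1| := by nlinarith [abs_nonneg x.1]
  induction n generalizing x with
  | zero => exact ⟨0, by simp [down], by simp [down], by simp [down]⟩
  | succ n ih =>
    have hxn := hx n n.lt_succ_self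
    have habs := abs_step_fst (q := q) (k := n) x
    obtain ⟨m, h1, h2, h3⟩ := ih (x := step q n x) (by rwa [habs]) (by rwa [habs])
      (fun k hk => (abs_step_snd_le hq₀ hq₁ hxn hτ').trans_lt
        (pow_lt_pow_right_of_lt_one₀ hq₀ hq₁ hk)) (by rwa [habs])
    rw [habs] at h2 h3
    rcases dualMoment_step hq₀ hq₁ hxn (by linarith) with ⟨h4, h5⟩ | ⟨h4, h5, h6⟩
    · rw [h5] at h2 h3
      exact ⟨m, by rw [down, h1, h4], h2, h3⟩
    · refine ⟨m + 1, by rw [down, h1, h4]; ring, ?_, ?_⟩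
      · rw [down, pow_succ', mul_assoc]
        exact (mul_le_mul_of_nonneg_left h2 (bounceRatio_pos hτ).le).trans h5
      · rw [down, pow_succ' (bounceRatio _), mul_assoc]
        exact h6.trans (mul_le_mul_of_nonneg_left h3 (bounceRatio_pos ht).le)

/-! ### Parity of the number of reflections -/

theorem abs_down_fst (n : ℕ) (x : ℝ × ℝ) : |(down q n x).1| = |x.1| := by
  induction n generalizing x with
  | zero => rfl
  | succ n ih => rw [down, ih, abs_step_fst]

theorem abs_down_snd_le (hq₀ : 0 < q) (hq₁ : q < 1) {n : ℕ} {x : ℝ × ℝ}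
    (hτ : |x.1| * (1 - q) < 2) (hx : |x.2| < q ^ n) : |(down q (n + 1) x).2| ≤ 1 := by
  induction n generalizing x with
  | zero => simpa [down] using abs_step_snd_le hq₀ hq₁ hx hτ
  | succ n ih =>
    exact ih (by rwa [abs_step_fst]) ((abs_step_snd_le hq₀ hq₁ hx hτ).trans_lt
      (pow_lt_pow_right_of_lt_one₀ hq₀ hq₁ n.lt_succ_self))

/-- A reflection by a ceiling changes the conserved quantity in the same way as a reflection by a
wall. -/
theorem moment_turn (hq₀ : 0 < q) {x : ℝ × ℝ} (hτ : 0 < |x.1|) (h1 : q ^ (k + 1) < |x.2|)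
    (h2 : |x.2| ≤ q ^ k) :
    (bounceRatio (|x.1| * q) * moment x (q ^ (k + 1)) ≤ dualMoment x (q ^ (k + 1)) ∧
      dualMoment x (q ^ (k + 1)) ≤ bounceRatio |x.1| * moment x (q ^ (k + 1))) ∨
    (bounceRatio (|x.1| * q) * dualMoment x (q ^ (k + 1)) ≤ moment x (q ^ (k + 1)) ∧
      moment x (q ^ (k + 1)) ≤ bounceRatio |x.1| * dualMoment x (q ^ (k + 1))) := by
  obtain ⟨τ, y⟩ := x
  dsimp only at *
  have e2 : τ ^ 2 = |τ| * |τ| := by rw [abs_mul_abs_self, sq]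
  have key : ∀ z : ℝ, z = |τ| * |y| →
      bounceRatio (|τ| * q) * (z + τ ^ 2 * q ^ (k + 1)) ≤ -z + τ ^ 2 * q ^ (k + 1) ∧
      -z + τ ^ 2 * q ^ (k + 1) ≤ bounceRatio |τ| * (z + τ ^ 2 * q ^ (k + 1)) := by
    rintro z rfl
    -- The ceiling behaves like a wall at distance |y|, because its height also lies between q|y|
    -- and |y|.
    have h3 : q * |y| ≤ q ^ (k + 1) := by rw [pow_succ']; gcongr
    have h4 := mul_pos hτ hτ
    have := bounceRatio_mul_le (q := q) (w := |y|) (M := |τ| * |y| + τ ^ 2 * q ^ (k + 1)) hτ hq₀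
      (by rw [e2]; nlinarith) (by rw [e2]; nlinarith)
    have e : |τ| * |y| + τ ^ 2 * q ^ (k + 1) - 2 * |τ| * |y| =
      -(|τ| * |y|) + τ ^ 2 * q ^ (k + 1) := by ring
    rwa [e] at this
  simp only [moment, dualMoment]
  rcases le_or_gt 0 (τ * y) with h | h
  · left
    exact key (τ * y) (by rw [← abs_mul, abs_of_nonneg h])
  · right
    have := key (-(τ * y)) (by rw [← abs_mul, abs_of_neg h])
    rwa [neg_neg] at this

/-- Two numbers of the same fundamental domain whose orbits nearly meet have nearly met after
equally many multiplications. -/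
theorem exponent_unique {κ ρ lo hi M M' X : ℝ} {C i j : ℕ} (hκ₀ : 0 < κ) (hκ₁ : κ ≤ 1)
    (hρ₀ : 0 < ρ) (hρ₁ : ρ < 1) (hlo : lo = ρ * hi) (hM : M ≤ hi) (hM₁ : lo ≤ M')
    (hM₂ : M' ≤ hi) (hhi : 0 < hi) (hX : ρ ^ C * hi < X) (h₁ : M < κ ^ C * hi)
    (h₂ : lo < κ ^ C * M) (i₁ : (κ * ρ) ^ i * M ≤ X) (i₂ : X ≤ ρ ^ i * M)
    (j₁ : (κ * ρ) ^ j * M' ≤ X) (j₂ : X ≤ ρ ^ j * M') : i = j := by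
  have hM0 : 0 < M := by
    have : 0 < κ ^ C * M := lt_trans (by rw [hlo]; positivity) h₂
    exact pos_of_mul_pos_right this (by positivity)
  have hM'0 : 0 < M' := lt_of_lt_of_le (by rw [hlo]; positivity) hM₁
  -- Since X stays above ρ^C hi, at most C factors can have been used; this bounds the accumulated
  -- error by κ^C.
  have bound : ∀ {n : ℕ} {Y : ℝ}, Y ≤ hi → X ≤ ρ ^ n * Y → n ≤ C := by
    intro n Y hY h
    by_contra! hn
    have h3 : ρ ^ n ≤ ρ ^ C := pow_le_pow_of_le_one hρ₀.le hρ₁.le hn.le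
    have h4 : ρ ^ n * Y ≤ ρ ^ n * hi := by gcongr
    nlinarith
  have hi' := bound hM i₂
  have hj' := bound hM₂ j₂
  have cancel : ∀ {m n : ℕ} {Y Z : ℝ}, m ≤ C → m < n → 0 < Y → 0 < Z →
      (κ * ρ) ^ m * Y ≤ ρ ^ n * Z → κ ^ C * Y ≤ ρ * Z := by
    intro m n Y Z hm hmn hY hZ h
    have h3 : ρ ^ n ≤ ρ ^ (m + 1) := pow_le_pow_of_le_one hρ₀.le hρ₁.le hmn
    have h4 : κ ^ C ≤ κ ^ m := pow_le_pow_of_le_one hκ₀.le hκ₁ hm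
    have h5 : ρ ^ m * (κ ^ C * Y) ≤ ρ ^ m * (ρ * Z) := by
      calc ρ ^ m * (κ ^ C * Y) ≤ ρ ^ m * (κ ^ m * Y) := by gcongr
        _ = (κ * ρ) ^ m * Y := by rw [mul_pow]; ring
        _ ≤ ρ ^ n * Z := h
        _ ≤ ρ ^ (m + 1) * Z := by gcongr
        _ = ρ ^ m * (ρ * Z) := by ring
    exact le_of_mul_le_mul_left h5 (by positivity)
  -- Only M has to stay away from the ends of the fundamental domain: i < j would force it to the
  -- lower end, j < i to the upper one.
  rcases lt_trichotomy i j with h | h | h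
  · have h3 := cancel hi' h hM0 hM'0 (i₁.trans j₂)
    have : ρ * M' ≤ ρ * hi := by gcongr
    linarith
  · exact h
  · have h3 := cancel hj' h hM'0 hM0 (j₁.trans i₂)
    have : κ ^ C * (ρ * hi) ≤ κ ^ C * M' := by rw [← hlo]; gcongr
    have h5 : ρ * (κ ^ C * hi) ≤ ρ * M := by linarith
    linarith [le_of_mul_le_mul_left h5 hρ₀]

theorem down_up_fst_of_close {x : ℝ × ℝ} {C n : ℕ} {h : ℝ} (hq₀ : 0 < q) (hq₁ : q < 1)
    (hy : |x.2| < 1) (hτ : 1 < |x.1| * q) (hτ' : |x.1| * (1 - q) < 2)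
    (hC : bounceRatio |x.1| ^ C * (|x.1| * (|x.1| + 1)) < |x.1| * h * (|x.1| * q - 1))
    (h₁ : moment x 1 < (bounceRatio (|x.1| * q) / bounceRatio |x.1|) ^ C * (|x.1| * (|x.1| + 1)))
    (h₂ : |x.1| * (|x.1| - 1) < (bounceRatio (|x.1| * q) / bounceRatio |x.1|) ^ C * moment x 1)
    (hn : h ≤ q ^ n) (hx : ∀ k ≤ n, |(up q k x).2| < q ^ k)
    (hturn : q ^ (n + 1) < |(up q (n + 1) x).2|) (hgen : |(up q (n + 1) x).2| ≠ q ^ n) :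
    (down q (n + 1) (up q (n + 1) x)).1 = -x.1 := by
  have ht : 1 < |x.1| := by nlinarith [abs_nonneg x.1]
  have hρ₀ := bounceRatio_pos ht
  have hρ₁ := bounceRatio_lt_one ht
  have hρq := bounceRatio_pos hτ
  have hab := abs_up_fst (q := q) (n + 1) x
  obtain ⟨m, m1, m2, m3⟩ := moment_up hq₀ hq₁ hτ (n + 1) fun k hk => hx k (by omega)
  have htop : |(up q (n + 1) x).2| < q ^ n :=
    lt_of_le_of_ne (abs_step_snd_le hq₀ hq₁ (hx n le_rfl) (by rwa [abs_up_fst])) hgen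
  set z := up q (n + 1) x with hz
  obtain ⟨m', d1, d2, d3⟩ := dualMoment_down hq₀ hq₁ (x := z) (by rwa [hab]) (by rwa [hab])
    (n + 1) fun k hk => htop.trans_le (pow_le_pow_of_le_one hq₀.le hq₁.le (by omega))
  have habz := abs_down_fst (q := q) (n + 1) z
  have hend : |(down q (n + 1) z).2| ≤ 1 := abs_down_snd_le hq₀ hq₁ (by rwa [hab]) htop
  set f := down q (n + 1) z with hf
  rw [hab] at habz d2 d3
  have sq_abs' : ∀ {s : ℝ}, |s| = |x.1| → s ^ 2 = |x.1| * |x.1| := by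
    intro s hs
    rw [← hs, abs_mul_abs_self, sq]
  have prod_abs : ∀ {s y b : ℝ}, |s| = |x.1| → |y| ≤ b → |s * y| ≤ |x.1| * b := by
    intro s y b hs hb
    rw [abs_mul, hs]; gcongr
  have b₀ := abs_le.1 (prod_abs rfl hy.le)
  have bf := abs_le.1 (prod_abs habz hend)
  have bz := abs_le.1 (prod_abs hab htop.le)
  -- At the turn r = q^(n+1) and |y| < q^n with q^n ≥ h, which keeps both quantities above a bound
  -- independent of n.
  have hzlow : ∀ X, X = moment z (q ^ (n + 1)) ∨ X = dualMoment z (q ^ (n + 1)) →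
      bounceRatio |x.1| ^ C * (|x.1| * (|x.1| + 1)) < X := by
    intro X hX
    refine hC.trans_le ?_
    have e : |x.1| * q ^ n * (|x.1| * q - 1) ≤ X := by
      rcases hX with rfl | rfl
      · rw [moment, sq_abs' hab, pow_succ]; linarith
      · rw [dualMoment, sq_abs' hab, pow_succ]; linarith
    refine le_trans ?_ e
    have : 0 < |x.1| * q - 1 := by linarith
    gcongr
  set κ := bounceRatio (|x.1| * q) / bounceRatio |x.1| with hκ
  have hκρ : κ * bounceRatio |x.1| = bounceRatio (|x.1| * q) := div_mul_cancel₀ _ hρ₀.ne'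
  have hκ₀ : 0 < κ := div_pos hρq hρ₀
  have hκ₁ : κ ≤ 1 := (div_le_one hρ₀).2
    (bounceRatio_mono hτ (mul_le_of_le_one_right (abs_nonneg _) hq₁.le))
  have hlo : |x.1| * (|x.1| - 1) = bounceRatio |x.1| * (|x.1| * (|x.1| + 1)) := by
    unfold bounceRatio; field_simp
  have hM : moment x 1 ≤ |x.1| * (|x.1| + 1) := by
    rw [moment, sq_abs' rfl]; linarith
  have hM₁ : |x.1| * (|x.1| - 1) ≤ dualMoment f 1 := by
    rw [dualMoment, sq_abs' habz]; linarith
  have hM₂ : dualMoment f 1 ≤ |x.1| * (|x.1| + 1) := by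
    rw [dualMoment, sq_abs' habz]; linarith
  rw [← hκρ] at m2 d2
  -- The factor of the ceiling belongs to the way in or to the way out according to the sign of τ y;
  -- either way the two wall counts differ by one.
  have hodd : Odd (m + m') := by
    rcases moment_turn hq₀ (by rw [hab]; linarith) hturn htop.le with ⟨t1, t2⟩ | ⟨t1, t2⟩ <;>
      rw [hab] at t1 t2 <;> rw [← hκρ] at t1
    · have : m + 1 = m' := by
        refine exponent_unique hκ₀ hκ₁ hρ₀ hρ₁ hlo hM hM₁ hM₂ (by positivity)
          (hzlow _ (.inr rfl)) h₁ h₂ ?_ ?_ d2 d3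
        · rw [pow_succ', mul_assoc]
          exact (mul_le_mul_of_nonneg_left m2 (by positivity)).trans t1
        · rw [pow_succ' (bounceRatio _), mul_assoc]
          exact t2.trans (mul_le_mul_of_nonneg_left m3 hρ₀.le)
      exact ⟨m, by omega⟩
    · have : m = m' + 1 := by
        refine exponent_unique hκ₀ hκ₁ hρ₀ hρ₁ hlo hM hM₁ hM₂ (by positivity)
          (hzlow _ (.inl rfl)) h₁ h₂ m2 m3 ?_ ?_
        · rw [pow_succ', mul_assoc]
          exact (mul_le_mul_of_nonneg_left d2 (by positivity)).trans t1
        · rw [pow_succ' (bounceRatio _), mul_assoc]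
          exact t2.trans (mul_le_mul_of_nonneg_left d3 hρ₀.le)
      exact ⟨m', by omega⟩
  rw [d1, m1, ← mul_assoc, ← pow_add, add_comm m', hodd.neg_one_pow, neg_one_mul]

/-- As `q → 1`, a given particle that turns back below a given height is retroreflected. -/
theorem eventually_retro {x : ℝ × ℝ} {h : ℝ} (hτ : 1 < |x.1|) (hy : |x.2| < 1) (hh : 0 < h) :
    ∀ᶠ q in 𝓝[<] (1 : ℝ), |x.1| * (1 - q) < 2 ∧ ∀ n : ℕ, h ≤ q ^ n →
      (∀ k ≤ n, |(up q k x).2| < q ^ k) → q ^ (n + 1) < |(up q (n + 1) x).2| →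
      |(up q (n + 1) x).2| ≠ q ^ n → (down q (n + 1) (up q (n + 1) x)).1 = -x.1 := by
  set t := |x.1| with ht
  have ht0 : 0 < t := by linarith
  -- C depends on x and h but not on q or n, so the remaining requirements are finitely many strict
  -- inequalities, continuous at q = 1 and true there because |y| < 1 < |τ|.
  obtain ⟨C, hC⟩ : ∃ C : ℕ, bounceRatio t ^ C < t * h * (t - 1) / (t * (t + 1)) := by
    refine exists_pow_lt_of_lt_one ?_ (bounceRatio_lt_one hτ)
    have : 0 < t - 1 := by linarith
    positivity
  rw [lt_div_iff₀ (by positivity)] at hC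
  have hsq : x.1 ^ 2 = t * t := by rw [ht, abs_mul_abs_self, sq]
  have hxy : |x.1 * x.2| < t := by
    rw [abs_mul, ← ht]; nlinarith
  rw [abs_lt] at hxy
  have c1 : ContinuousAt (fun q : ℝ => (bounceRatio (t * q) / bounceRatio t) ^ C) 1 := by
    unfold bounceRatio
    refine ContinuousAt.pow (ContinuousAt.div_const
      (ContinuousAt.div (by fun_prop) (by fun_prop) ?_) _) _
    rw [mul_one]; linarith
  have v1 : (bounceRatio (t * 1) / bounceRatio t) ^ C = 1 := by
    rw [mul_one, div_self (bounceRatio_pos hτ).ne', one_pow]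
  have E : ∀ f g : ℝ → ℝ, ContinuousAt f 1 → ContinuousAt g 1 → f 1 < g 1 →
      ∀ᶠ q in 𝓝[<] (1 : ℝ), f q < g q := fun f g hf hg hfg =>
    (hf.eventually_lt hg hfg).filter_mono nhdsWithin_le_nhds
  filter_upwards [self_mem_nhdsWithin,
    E (fun _ => 0) (fun q => q) (by fun_prop) (by fun_prop) (by norm_num),
    E (fun _ => 1) (fun q => t * q) (by fun_prop) (by fun_prop) (by linarith),
    E (fun q => t * (1 - q)) (fun _ => 2) (by fun_prop) (by fun_prop) (by norm_num),
    E (fun _ => bounceRatio t ^ C * (t * (t + 1))) (fun q => t * h * (t * q - 1)) (by fun_prop)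
      (by fun_prop) (by simpa using hC),
    E (fun _ => moment x 1) (fun q => (bounceRatio (t * q) / bounceRatio t) ^ C * (t * (t + 1)))
      (by fun_prop) (c1.mul (by fun_prop)) (by simp only [v1, moment, hsq]; linarith),
    E (fun _ => t * (t - 1)) (fun q => (bounceRatio (t * q) / bounceRatio t) ^ C * moment x 1)
      (by fun_prop) (c1.mul (by fun_prop)) (by simp only [v1, moment, hsq]; linarith)]
    with q g1 g2 g3 g4 g5 g6 g7
  exact ⟨g4, fun n hn hx hturn hgen =>
    down_up_fst_of_close g2 g1 hy g3 g4 g5 g6 g7 hn hx hturn hgen⟩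

end Invariant

section Estimates

/-! ### Measure estimates for the motion -/

variable {q w Δ : ℝ} {k : ℕ} {ν : Measure ℝ}

theorem measurable_levelMap : Measurable (levelMap w Δ) := by
  unfold levelMap
  refine Measurable.ite (measurableSet_lt (by fun_prop) (by fun_prop)) (by fun_prop) ?_
  exact Measurable.ite (measurableSet_lt (by fun_prop) (by fun_prop)) (by fun_prop) (by fun_prop)

theorem measurable_step : Measurable (step q k) := measurable_levelMap

theorem measurable_up (n : ℕ) : Measurable (up q n) := by
  induction n with
  | zero => exact measurable_id
  | succ n ih => exact measurable_step.comp ih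

theorem measurable_down (n : ℕ) : Measurable (down q n) := by
  induction n with
  | zero => exact measurable_id
  | succ n ih => exact ih.comp measurable_step

theorem ae_abs_snd_ne (c : ℝ) : ∀ᵐ x ∂(ν.prod volume), |x.2| ≠ c := by
  refine Measure.quasiMeasurePreserving_snd.ae (p := fun y : ℝ => |y| ≠ c) ?_
  have : {y : ℝ | ¬ |y| ≠ c} ⊆ {c, -c} := by
    intro y hy
    have hy : |y| = c := not_not.1 hy
    rcases abs_choice y with h | h
    · left; rw [← hy, h]
    · right; rw [mem_singleton_iff, ← hy, h, neg_neg]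
  exact measure_mono_null this ((Set.toFinite _).measure_zero _)

variable [IsFiniteMeasure ν]

theorem measurePreserving_shear :
    MeasurePreserving (fun x : ℝ × ℝ => (x.1, x.2 + x.1 * Δ)) (ν.prod volume) (ν.prod volume) :=
  (MeasurePreserving.id ν).skew_product (g := fun τ y => y + τ * Δ) (by fun_prop)
    (ae_of_all _ fun τ => (measurePreserving_add_right volume (τ * Δ)).map_eq)

theorem measurePreserving_shear_reflect (hν : MeasurePreserving (fun τ : ℝ => -τ) ν ν) (b : ℝ) :
    MeasurePreserving (fun x : ℝ × ℝ => (-x.1, b - (x.2 + x.1 * Δ)))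
      (ν.prod volume) (ν.prod volume) :=
  hν.skew_product (g := fun τ y => b - (y + τ * Δ)) (by fun_prop)
    (ae_of_all _ fun τ => ((Measure.measurePreserving_sub_left volume b).comp
      (measurePreserving_add_right volume (τ * Δ))).map_eq)

/-- Each of the three branches preserves the measure, which is enough for null sets. It serves to
discard the trajectories through vertices. -/
theorem quasiMeasurePreserving_levelMap (hν : MeasurePreserving (fun τ : ℝ => -τ) ν ν) :
    Measure.QuasiMeasurePreserving (levelMap w Δ) (ν.prod volume) (ν.prod volume) := by
  refine ⟨measurable_levelMap, Measure.AbsolutelyContinuous.mk fun s hs h0 => ?_⟩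
  rw [Measure.map_apply measurable_levelMap hs]
  refine measure_mono_null (t := (fun x : ℝ × ℝ => (x.1, x.2 + x.1 * Δ)) ⁻¹' s ∪
    ((fun x : ℝ × ℝ => (-x.1, 2 * w - (x.2 + x.1 * Δ))) ⁻¹' s ∪
     (fun x : ℝ × ℝ => (-x.1, -(2 * w) - (x.2 + x.1 * Δ))) ⁻¹' s)) ?_ ?_
  · intro x hx
    rw [mem_preimage, levelMap] at hx
    split_ifs at hx
    exacts [.inl hx, .inr (.inl hx), .inr (.inr hx)]
  · rw [measure_union_null_iff, measure_union_null_iff]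
    exact ⟨measurePreserving_shear.quasiMeasurePreserving.preimage_null h0,
      (measurePreserving_shear_reflect hν _).quasiMeasurePreserving.preimage_null h0,
      (measurePreserving_shear_reflect hν _).quasiMeasurePreserving.preimage_null h0⟩

/-- The motion across a rectangle is injective and preserves the measure piecewise. -/
theorem measure_levelMap_preimage_le (hν : MeasurePreserving (fun τ : ℝ => -τ) ν ν) (hw : 0 ≤ w)
    {s : Set (ℝ × ℝ)} (hs : MeasurableSet s) :
    ν.prod volume ({x | |x.2| < w} ∩ levelMap w Δ ⁻¹' s) ≤ ν.prod volume s := by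
  -- Prolonging the outgoing flight backwards separates the branches: it ends inside the strip,
  -- beyond w or beyond -w according to the wall that was met.
  set H₀ : Set (ℝ × ℝ) := {x | |x.2 - x.1 * Δ| < w}
  set H₁ : Set (ℝ × ℝ) := {x | w < x.2 - x.1 * Δ}
  set H₂ : Set (ℝ × ℝ) := {x | x.2 - x.1 * Δ < -w}
  have m₀ : MeasurableSet H₀ := measurableSet_lt (by fun_prop) (by fun_prop)
  have m₁ : MeasurableSet H₁ := measurableSet_lt (by fun_prop) (by fun_prop)
  have m₂ : MeasurableSet H₂ := measurableSet_lt (by fun_prop) (by fun_prop)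
  have hsub : {x : ℝ × ℝ | |x.2| < w} ∩ levelMap w Δ ⁻¹' s ⊆
      (fun x : ℝ × ℝ => (x.1, x.2 + x.1 * Δ)) ⁻¹' (s ∩ H₀) ∪
      ((fun x : ℝ × ℝ => (-x.1, 2 * w - (x.2 + x.1 * Δ))) ⁻¹' (s ∩ H₁) ∪
       (fun x : ℝ × ℝ => (-x.1, -(2 * w) - (x.2 + x.1 * Δ))) ⁻¹' (s ∩ H₂)) := by
    rintro x ⟨hx, hx'⟩
    have hx : |x.2| < w := hx
    have hb := abs_lt.1 hx
    rw [mem_preimage, levelMap] at hx'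
    split_ifs at hx'
    · refine .inl ⟨hx', ?_⟩
      change |x.2 + x.1 * Δ - x.1 * Δ| < w
      rwa [add_sub_cancel_right]
    · refine .inr (.inl ⟨hx', ?_⟩)
      change w < 2 * w - (x.2 + x.1 * Δ) - -x.1 * Δ
      linarith
    · refine .inr (.inr ⟨hx', ?_⟩)
      change -(2 * w) - (x.2 + x.1 * Δ) - -x.1 * Δ < -w
      linarith
  refine (measure_mono hsub).trans ((measure_union_le _ _).trans
    ((add_le_add_right (measure_union_le _ _) _).trans ?_))
  rw [measurePreserving_shear.measure_preimage (hs.inter m₀).nullMeasurableSet,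
    (measurePreserving_shear_reflect hν _).measure_preimage (hs.inter m₁).nullMeasurableSet,
    (measurePreserving_shear_reflect hν _).measure_preimage (hs.inter m₂).nullMeasurableSet]
  have d₁ : Disjoint (s ∩ H₁) (s ∩ H₂) := by
    rw [Set.disjoint_left]
    rintro x ⟨-, h1⟩ ⟨-, h2⟩
    have h1 : w < x.2 - x.1 * Δ := h1
    have h2 : x.2 - x.1 * Δ < -w := h2
    linarith
  have d₀ : Disjoint (s ∩ H₀) (s ∩ H₁ ∪ s ∩ H₂) := by
    rw [Set.disjoint_left]
    rintro x ⟨-, h0⟩ (⟨-, h1⟩ | ⟨-, h1⟩)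
    · have h1 : w < x.2 - x.1 * Δ := h1
      exact lt_asymm (abs_lt.1 h0).2 h1
    · have h1 : x.2 - x.1 * Δ < -w := h1
      exact lt_asymm (abs_lt.1 h0).1 h1
  rw [← measure_union d₁ (hs.inter m₂), ← measure_union d₀ ((hs.inter m₁).union (hs.inter m₂))]
  refine measure_mono (union_subset inter_subset_left (union_subset inter_subset_left
    inter_subset_left))

/-! ### Few particles penetrate deeply -/

/-- The particles that reach the `n`-th level. -/
def alive (q : ℝ) (n : ℕ) : Set (ℝ × ℝ) := {x | ∀ k ≤ n, |(up q k x).2| < q ^ k}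

theorem measurableSet_alive (n : ℕ) : MeasurableSet (alive q n) := by
  have : alive q n = ⋂ k ≤ n, {x | |(up q k x).2| < q ^ k} := by ext; simp [alive]
  rw [this]
  refine MeasurableSet.iInter fun k => MeasurableSet.iInter fun _ => ?_
  exact measurableSet_lt (measurable_snd.comp (measurable_up k)).abs measurable_const

theorem measure_alive_inter_le (hν : MeasurePreserving (fun τ : ℝ => -τ) ν ν) (hq₀ : 0 < q)
    (n : ℕ) {s : Set (ℝ × ℝ)} (hs : MeasurableSet s) :
    ν.prod volume (alive q n ∩ up q n ⁻¹' s) ≤ ν.prod volume s := by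
  induction n generalizing s with
  | zero => exact measure_mono inter_subset_right
  | succ n ih =>
    have hms : MeasurableSet ({x : ℝ × ℝ | |x.2| < q ^ n} ∩ step q n ⁻¹' s) :=
      (measurableSet_lt (by fun_prop) (by fun_prop)).inter (measurable_step hs)
    refine (measure_mono ?_).trans ((ih hms).trans
      (measure_levelMap_preimage_le hν (by positivity) hs))
    rintro x ⟨h1, h2⟩
    exact ⟨fun k hk => h1 k (by omega), h1 n (by omega), h2⟩

/-- The map `up q n` sends these particles into the strip |y| < q^n without compressing the measure.
-/
theorem measure_alive_le (hν : MeasurePreserving (fun τ : ℝ => -τ) ν ν) (hq₀ : 0 < q) (n : ℕ) :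
    ν.prod volume (alive q n) ≤ ν univ * ENNReal.ofReal (2 * q ^ n) := by
  have hms : MeasurableSet {x : ℝ × ℝ | |x.2| < q ^ n} :=
    measurableSet_lt (by fun_prop) (by fun_prop)
  have h1 : alive q n ⊆ alive q n ∩ up q n ⁻¹' {x : ℝ × ℝ | |x.2| < q ^ n} :=
    fun x hx => ⟨hx, hx n le_rfl⟩
  have h2 : {x : ℝ × ℝ | |x.2| < q ^ n} = univ ×ˢ Ioo (-q ^ n) (q ^ n) := by
    ext x; simp [abs_lt]
  refine (measure_mono h1).trans ((measure_alive_inter_le hν hq₀ n hms).trans ?_)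
  rw [h2, Measure.prod_prod, Real.volume_Ioo]
  apply le_of_eq
  congr 2
  ring

theorem quasiMeasurePreserving_up (hν : MeasurePreserving (fun τ : ℝ => -τ) ν ν) (n : ℕ) :
    Measure.QuasiMeasurePreserving (up q n) (ν.prod volume) (ν.prod volume) := by
  induction n with
  | zero => exact Measure.QuasiMeasurePreserving.id _
  | succ n ih => exact (quasiMeasurePreserving_levelMap hν).comp ih

theorem ae_avoidsDown (hν : MeasurePreserving (fun τ : ℝ => -τ) ν ν) (n : ℕ) :
    ∀ᵐ x ∂(ν.prod volume), AvoidsDown q n x := by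
  induction n with
  | zero => exact ae_of_all _ fun _ => trivial
  | succ n ih =>
    have hq : Measure.QuasiMeasurePreserving (step q n) (ν.prod volume) (ν.prod volume) :=
      quasiMeasurePreserving_levelMap hν
    filter_upwards [hq.ae (ae_abs_snd_ne (q ^ n)), hq.ae ih] with x h1 h2
    exact ⟨h1, h2⟩

/-! ### Retroreflection of almost all particles as q → 1 -/

/-- The particle turns back in the `n`-th level without meeting a vertex. -/
def TurnsAt (q : ℝ) (n : ℕ) (x : ℝ × ℝ) : Prop :=
  (∀ k ≤ n, |(up q k x).2| < q ^ k) ∧ q ^ (n + 1) < |(up q (n + 1) x).2| ∧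
    |(up q (n + 1) x).2| ≠ q ^ n

/-- The particle leaves the hollow with the velocity opposite to the initial one. -/
def Retro (q : ℝ) (x : ℝ × ℝ) : Prop :=
  |x.1| * (1 - q) < 2 ∧ ∃ n, TurnsAt q n x ∧ AvoidsDown q (n + 1) (up q (n + 1) x) ∧
    (down q (n + 1) (up q (n + 1) x)).1 = -x.1

/-- The particles whose displacement spoils the retroreflection although they turn back before
reaching the relative height `h`. -/
def defect (q h : ℝ) : Set (ℝ × ℝ) :=
  {x | (1 < |x.1| ∧ |x.2| < 1) ∧ (2 ≤ |x.1| * (1 - q) ∨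
    ∃ n : ℕ, h ≤ q ^ n ∧ TurnsAt q n x ∧ (down q (n + 1) (up q (n + 1) x)).1 ≠ -x.1)}

theorem measurableSet_defect (q h : ℝ) : MeasurableSet (defect q h) := by
  have mu : ∀ n, Measurable fun x => |(up q n x).2| := fun n =>
    (measurable_snd.comp (measurable_up n)).abs
  have heq : defect q h = ({x | 1 < |x.1|} ∩ {x | |x.2| < 1}) ∩ ({x | 2 ≤ |x.1| * (1 - q)} ∪
      ⋃ n : ℕ, ⋃ _ : h ≤ q ^ n, (alive q n ∩ ({x | q ^ (n + 1) < |(up q (n + 1) x).2|} ∩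
        {x | |(up q (n + 1) x).2| = q ^ n}ᶜ)) ∩
          {x | (down q (n + 1) (up q (n + 1) x)).1 = -x.1}ᶜ) := by
    ext x
    simp [defect, TurnsAt, alive]
    exact fun _ _ => or_congr_right (exists_congr fun n => and_left_comm)
  rw [heq]
  refine MeasurableSet.inter (MeasurableSet.inter (measurableSet_lt (by fun_prop) (by fun_prop))
    (measurableSet_lt (by fun_prop) (by fun_prop)))
    (MeasurableSet.union (measurableSet_le (by fun_prop) (by fun_prop)) ?_)
  refine MeasurableSet.iUnion fun n => MeasurableSet.iUnion fun _ =>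
    (MeasurableSet.inter (MeasurableSet.inter (measurableSet_alive n)
      (MeasurableSet.inter (measurableSet_lt measurable_const (mu _)) ?_)) ?_)
  · exact (measurableSet_eq_fun (mu _) measurable_const).compl
  · exact (measurableSet_eq_fun (measurable_fst.comp ((measurable_down _).comp (measurable_up _)))
      (by fun_prop)).compl

/-- By `eventually_retro` each point leaves the defect once q is close enough to 1. No uniformity in
the point is needed, since μ is finite and dominated convergence applies. -/
theorem tendsto_measure_defect (μ : Measure (ℝ × ℝ)) [IsFiniteMeasure μ] {h : ℝ} (hh : 0 < h) :
    Tendsto (fun q => μ (defect q h)) (𝓝[<] 1) (𝓝 0) := by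
  have := tendsto_measure_of_ae_tendsto_indicator_of_isFiniteMeasure (μ := μ) (𝓝[<] (1 : ℝ))
    (A := ∅) (As := fun q => defect q h) MeasurableSet.empty
    (fun q => measurableSet_defect q h) (ae_of_all _ fun x => ?_)
  · simpa using this
  · by_cases hx : 1 < |x.1| ∧ |x.2| < 1
    · filter_upwards [eventually_retro hx.1 hx.2 hh] with q hq
      simp only [mem_empty_iff_false, iff_false]
      rintro ⟨-, h1 | ⟨n, h1, h2, h3⟩⟩
      · linarith [hq.1]
      · exact h3 (hq.2 n h1 h2.1 h2.2.1 h2.2.2)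
    · refine Eventually.of_forall fun q => ?_
      simp only [mem_empty_iff_false, iff_false]
      exact fun h => hx h.1

/-- Almost every particle that is not retroreflected is in one of the exceptional sets. -/
theorem ae_retro (hν : MeasurePreserving (fun τ : ℝ => -τ) ν ν) {h : ℝ} {n : ℕ}
    (hn : ∀ k < n, h ≤ q ^ k) : ∀ᵐ x ∂(ν.prod volume), 1 < |x.1| → |x.2| < 1 →
      x ∉ defect q h → x ∉ alive q n → Retro q x := by
  have g1 : ∀ᵐ x ∂(ν.prod volume), ∀ k, |(up q (k + 1) x).2| ≠ q ^ k := by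
    rw [ae_all_iff]
    exact fun k => (quasiMeasurePreserving_up hν (k + 1)).ae (ae_abs_snd_ne (q ^ k))
  have g2 : ∀ᵐ x ∂(ν.prod volume), ∀ k, |(up q k x).2| ≠ q ^ k := by
    rw [ae_all_iff]
    exact fun k => (quasiMeasurePreserving_up hν k).ae (ae_abs_snd_ne (q ^ k))
  have g3 : ∀ᵐ x ∂(ν.prod volume), ∀ k, AvoidsDown q (k + 1) (up q (k + 1) x) := by
    rw [ae_all_iff]
    exact fun k => (quasiMeasurePreserving_up hν (k + 1)).ae (ae_avoidsDown hν (k + 1))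
  filter_upwards [g1, g2, g3] with x g1 g2 g3 hτ hy hdef hal
  -- The first level too narrow for the particle at its bottom; the turn takes place at the ceiling
  -- of the level before it.
  have hex : ∃ k, k ≤ n ∧ q ^ k ≤ |(up q k x).2| := by
    by_contra! hcon
    exact hal hcon
  classical
  obtain ⟨hk, hk'⟩ := Nat.find_spec hex
  have hmin : ∀ j < Nat.find hex, |(up q j x).2| < q ^ j := by
    intro j hj
    have := Nat.find_min hex hj
    by_contra! hcon
    exact this ⟨by omega, hcon⟩
  set k := Nat.find hex
  obtain hk0 | ⟨j, hkj⟩ : k = 0 ∨ ∃ j, k = j + 1 := by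
    cases k with
    | zero => exact .inl rfl
    | succ j => exact .inr ⟨j, rfl⟩
  · rw [hk0, up, pow_zero] at hk'
    linarith
  · rw [hkj] at hk hk' hmin
    have hturn : TurnsAt q j x :=
      ⟨fun i hi => hmin i (by omega), lt_of_le_of_ne hk' (g2 (j + 1)).symm, g1 j⟩
    refine ⟨?_, j, hturn, g3 j, ?_⟩
    · by_contra! hcon
      exact hdef ⟨⟨hτ, hy⟩, .inl hcon⟩
    · by_contra hcon
      exact hdef ⟨⟨hτ, hy⟩, .inr ⟨j, hn j (by omega), hturn, hcon⟩⟩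

/-- The height h is fixed before q: deep particles cost ε/2 for all q, the defect costs ε/2 only for
q near 1. The finite measure μ is needed for the defect, the invariant product measure for the deep
particles. -/
theorem eventually_measure_not_retro_le (hν : MeasurePreserving (fun τ : ℝ => -τ) ν ν)
    {μ : Measure (ℝ × ℝ)} [IsFiniteMeasure μ] (hμ : μ ≤ ν.prod volume) {ε : ENNReal}
    (hε : 0 < ε) :
    ∀ᶠ q in 𝓝[<] (1 : ℝ), μ {x | 1 < |x.1| ∧ |x.2| < 1 ∧ ¬ Retro q x} ≤ ε := by
  obtain ⟨h, hh, hh'⟩ : ∃ h : ℝ, 0 < h ∧ ν univ * ENNReal.ofReal (2 * h) ≤ ε / 2 := by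
    have ht : Tendsto (fun h : ℝ => ν univ * ENNReal.ofReal (2 * h)) (𝓝[>] 0) (𝓝 0) := by
      have : Tendsto (fun h : ℝ => ENNReal.ofReal (2 * h)) (𝓝[>] 0) (𝓝 (ENNReal.ofReal (2 * 0))) :=
        (ENNReal.continuous_ofReal.comp (by fun_prop : Continuous fun h : ℝ => 2 * h)).tendsto 0
          |>.mono_left nhdsWithin_le_nhds
      simpa using ENNReal.Tendsto.const_mul this (.inr (measure_ne_top ν univ))
    obtain ⟨h, h1, h2⟩ := ((ht.eventually_le_const (ENNReal.half_pos hε.ne')).and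
      self_mem_nhdsWithin).exists
    exact ⟨h, h2, h1⟩
  filter_upwards [(tendsto_measure_defect μ hh).eventually_le_const (ENNReal.half_pos hε.ne'),
    self_mem_nhdsWithin, (lt_mem_nhds (zero_lt_one' ℝ)).filter_mono nhdsWithin_le_nhds]
    with q h1 hq₁ hq₀
  have hq₀ : 0 < q := hq₀
  have hex : ∃ n : ℕ, q ^ n < h := exists_pow_lt_of_lt_one hh hq₁
  classical
  set n := Nat.find hex
  have hn : q ^ n < h := Nat.find_spec hex
  have hn' : ∀ k < n, h ≤ q ^ k := fun k hk => not_lt.1 (Nat.find_min hex hk)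
  have hae := (Measure.absolutelyContinuous_of_le hμ).ae_le (ae_retro (q := q) hν hn')
  calc μ {x | 1 < |x.1| ∧ |x.2| < 1 ∧ ¬ Retro q x} ≤ μ (defect q h ∪ alive q n) := by
        refine measure_mono_ae ?_
        filter_upwards [hae] with x hx hx'
        by_contra hcon
        have hcon' : ¬ (x ∈ defect q h ∨ x ∈ alive q n) := hcon
        rw [not_or] at hcon'
        exact hx'.2.2 (hx hx'.1 hx'.2.1 hcon'.1 hcon'.2)
    _ ≤ ε / 2 + ε / 2 := by
        refine (measure_union_le _ _).trans (add_le_add h1 ?_)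
        refine ((hμ _).trans (measure_alive_le hν hq₀ n)).trans (le_trans ?_ hh')
        gcongr
    _ = ε := ENNReal.add_halves ε

end Estimates

section Limit

/-! ### The exit angle -/

variable {a q : ℝ}

theorem outerNormal_opening (ha : 0 < a) : outerNormal ⟨-a, -1⟩ ⟨a, -1⟩ = -Complex.I := by
  have h : (⟨a, -1⟩ : ℂ) - ⟨-a, -1⟩ = ((2 * a : ℝ) : ℂ) := by
    apply Complex.ext <;> simp; ring
  rw [outerNormal, h, Complex.norm_real, Real.norm_of_nonneg (by linarith), div_self, mul_one]
  exact_mod_cast (by linarith : 2 * a ≠ 0)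

theorem rotate_neg_outerNormal (ha : 0 < a) (φ : ℝ) :
    rotate (-outerNormal ⟨-a, -1⟩ ⟨a, -1⟩) φ = ⟨-Real.sin φ, Real.cos φ⟩ := by
  rw [outerNormal_opening ha, rotate, Complex.exp_mul_I, ← Complex.ofReal_cos, ← Complex.ofReal_sin]
  apply Complex.ext <;> simp [-Complex.ofReal_sin, -Complex.ofReal_cos]

theorem rotate_outerNormal (ha : 0 < a) (ψ : ℝ) :
    rotate (outerNormal ⟨-a, -1⟩ ⟨a, -1⟩) ψ = ⟨Real.sin ψ, -Real.cos ψ⟩ := by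
  rw [outerNormal_opening ha, rotate, Complex.exp_mul_I, ← Complex.ofReal_cos, ← Complex.ofReal_sin]
  apply Complex.ext <;> simp [-Complex.ofReal_sin, -Complex.ofReal_cos]

theorem entrance_eq_pos (a ξ : ℝ) :
    (⟨-a, -1⟩ : ℂ) + ξ • ((⟨a, -1⟩ : ℂ) - ⟨-a, -1⟩) = pos a (2 * ξ - 1) 1 := by
  apply Complex.ext
  · simp [pos]; ring
  · simp [pos]

theorem Exits.im_neg (ha : 0 < a) {p v w : ℂ} (h : Exits (hollow a q) ⟨-a, -1⟩ ⟨a, -1⟩ p v w) :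
    w.im < 0 := by
  obtain ⟨z, hz, t, ht, hs⟩ := h.exists_leave
  have h1 := (hs (t / 2) ⟨by linarith, by linarith⟩).1
  rw [Complex.add_im, ((mem_opening_iff ha).1 hz).1, Complex.smul_im, smul_eq_mul,
    Complex.neg_im] at h1
  by_contra! hcon
  nlinarith

/-- The particle with the initial data `x` leaves with the velocity `w`. -/
def ExitsFrom (a q : ℝ) (x : ℝ × ℝ) (w : ℂ) : Prop :=
  |2 * x.1 - 1| < 1 ∧ Exits (hollow a q) ⟨-a, -1⟩ ⟨a, -1⟩ (pos a (2 * x.1 - 1) 1)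
    ⟨-Real.sin x.2, Real.cos x.2⟩ w

theorem pos_mem_opening_iff (ha : 0 < a) (y : ℝ) :
    pos a y 1 ∈ openSegment ℝ (⟨-a, -1⟩ : ℂ) ⟨a, -1⟩ ↔ |y| < 1 := by
  rw [mem_opening_iff ha]
  simp only [pos, true_and, abs_mul, abs_of_pos ha]
  constructor
  · intro h; by_contra! hc; nlinarith
  · intro h; nlinarith

theorem scatters_hollow_iff (ha : 0 < a) {x : ℝ × ℝ} {ψ : ℝ} :
    Scatters (hollow a q) ⟨-a, -1⟩ ⟨a, -1⟩ x.1 x.2 ψ ↔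
    ψ ∈ Icc (-(Real.pi / 2)) (Real.pi / 2) ∧ ExitsFrom a q x ⟨Real.sin ψ, -Real.cos ψ⟩ := by
  rw [scatters_iff, rotate_outerNormal ha, rotate_neg_outerNormal ha, entrance_eq_pos,
    pos_mem_opening_iff ha, ExitsFrom]

/-- The speed is 1 and the exit velocity points downwards, so its horizontal component determines
the angle. -/
theorem ExitsFrom.scatters (ha : 0 < a) {x : ℝ × ℝ} {w : ℂ} (h : ExitsFrom a q x w) :
    Scatters (hollow a q) ⟨-a, -1⟩ ⟨a, -1⟩ x.1 x.2 (Real.arcsin w.re) := by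
  have hnorm : w.re ^ 2 + w.im ^ 2 = 1 := by
    have h1 := h.2.norm_eq
    have h2 : ‖(⟨-Real.sin x.2, Real.cos x.2⟩ : ℂ)‖ ^ 2 = 1 := by
      rw [← Complex.normSq_eq_norm_sq, Complex.normSq_apply]
      simp only
      nlinarith [Real.sin_sq_add_cos_sq x.2]
    rw [← h1, ← Complex.normSq_eq_norm_sq, Complex.normSq_apply] at h2
    linarith
  have him := h.2.im_neg ha
  rw [scatters_hollow_iff ha]
  refine ⟨Real.arcsin_mem_Icc _, ?_⟩
  convert h using 1
  apply Complex.ext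
  · exact Real.sin_arcsin (by nlinarith) (by nlinarith)
  · simp only [Real.cos_arcsin]
    have : 1 - w.re ^ 2 = (-w.im) ^ 2 := by linarith
    rw [this, Real.sqrt_sq (by linarith), neg_neg]

theorem exitAngle_of_scatters (ha : 0 < a) {x : ℝ × ℝ} {ψ : ℝ}
    (h : Scatters (hollow a q) ⟨-a, -1⟩ ⟨a, -1⟩ x.1 x.2 ψ) :
    exitAngle (hollow a q) ⟨-a, -1⟩ ⟨a, -1⟩ x = ψ := by
  have hex : ∃ ψ : ℝ, Scatters (hollow a q) ⟨-a, -1⟩ ⟨a, -1⟩ x.1 x.2 ψ := ⟨ψ, h⟩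
  rw [exitAngle, dif_pos hex]
  obtain ⟨h1, h2⟩ := (scatters_hollow_iff ha).1 hex.choose_spec
  obtain ⟨h3, h4⟩ := (scatters_hollow_iff ha).1 h
  have := congrArg Complex.re (h2.2.unique (opening_disjoint_hollow ha) h4.2)
  exact Real.injOn_sin h1 h3 this

/-- Needed for measurability: `Measure.map` has the value 0 on maps that are not almost everywhere
measurable. -/
theorem exitAngle_stable (ha : 0 < a) (hq₀ : 0 < q) (hq₁ : q < 1) {x : ℝ × ℝ}
    (hx : x ∈ regularData (hollow a q) ⟨-a, -1⟩ ⟨a, -1⟩) :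
    regularData (hollow a q) ⟨-a, -1⟩ ⟨a, -1⟩ ∈ 𝓝 x ∧
      ContinuousAt (exitAngle (hollow a q) ⟨-a, -1⟩ ⟨a, -1⟩) x := by
  obtain ⟨ψ, hψ⟩ := hx
  obtain ⟨-, hy, hex⟩ := (scatters_hollow_iff ha).1 hψ
  have hcp : Continuous fun x : ℝ × ℝ => pos a (2 * x.1 - 1) 1 :=
    Complex.equivRealProdCLM.symm.continuous.comp
      (by fun_prop : Continuous fun x : ℝ × ℝ => (a * (2 * x.1 - 1), (-1 : ℝ)))
  have hcv : Continuous fun x : ℝ × ℝ => (⟨-Real.sin x.2, Real.cos x.2⟩ : ℂ) :=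
    Complex.equivRealProdCLM.symm.continuous.comp
      (by fun_prop : Continuous fun x : ℝ × ℝ => (-Real.sin x.2, Real.cos x.2))
  obtain ⟨h1, h2⟩ := (mem_opening_iff ha).1 ((pos_mem_opening_iff ha _).2 hy)
  obtain ⟨W, hW, hW'⟩ := hex.stable (l := 𝓝 x) (isOpen_hollow hq₀ hq₁ ha) (opening_flat hq₀ hq₁ ha)
    (wall_away_from_opening hq₀ hq₁ ha) (isFlatBoundaryPoint_opening hq₀ hq₁ h1 h2)
    (hcp.tendsto x) (hcv.tendsto x)
    (Eventually.of_forall fun z => by rw [inner_eq_re_add_im]; simp [pos])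
  have hev : ∀ᶠ z in 𝓝 x,
      Scatters (hollow a q) ⟨-a, -1⟩ ⟨a, -1⟩ z.1 z.2 (Real.arcsin (W z).re) := by
    have hy' : ∀ᶠ z : ℝ × ℝ in 𝓝 x, |2 * z.1 - 1| < 1 :=
      (isOpen_lt (by fun_prop) (by fun_prop)).mem_nhds hy
    filter_upwards [hW', hy'] with z hz hz'
    exact ExitsFrom.scatters ha ⟨hz', hz⟩
  refine ⟨hev.mono fun z hz => ⟨_, hz⟩, ?_⟩
  have hlim : Tendsto (fun z => Real.arcsin (W z).re) (𝓝 x)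
      (𝓝 (exitAngle (hollow a q) ⟨-a, -1⟩ ⟨a, -1⟩ x)) := by
    have e : exitAngle (hollow a q) ⟨-a, -1⟩ ⟨a, -1⟩ x = Real.arcsin (Real.sin ψ) :=
      exitAngle_of_scatters ha (ExitsFrom.scatters ha (w := ⟨Real.sin ψ, -Real.cos ψ⟩) ⟨hy, hex⟩)
    rw [e]
    exact (Real.continuous_arcsin.tendsto _).comp
      ((Complex.continuous_re.tendsto ⟨Real.sin ψ, -Real.cos ψ⟩).comp hW)
  exact hlim.congr' (hev.mono fun z hz => (exitAngle_of_scatters ha hz).symm)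

theorem isOpen_regularData (ha : 0 < a) (hq₀ : 0 < q) (hq₁ : q < 1) :
    IsOpen (regularData (hollow a q) ⟨-a, -1⟩ ⟨a, -1⟩) :=
  isOpen_iff_mem_nhds.2 fun _ hx => (exitAngle_stable ha hq₀ hq₁ hx).1

theorem continuousOn_exitAngle (ha : 0 < a) (hq₀ : 0 < q) (hq₁ : q < 1) :
    ContinuousOn (exitAngle (hollow a q) ⟨-a, -1⟩ ⟨a, -1⟩)
      (regularData (hollow a q) ⟨-a, -1⟩ ⟨a, -1⟩) :=
  fun _ hx => (exitAngle_stable ha hq₀ hq₁ hx).2.continuousWithinAt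

/-- The state `(τ, y)` of the particle with initial data `(ξ, φ)`. -/
def initialState (a : ℝ) (x : ℝ × ℝ) : ℝ × ℝ := (-Real.tan x.2 / a, 2 * x.1 - 1)

theorem Retro.scatters (ha : 0 < a) (hq₀ : 0 < q) (hq₁ : q < 1) {x : ℝ × ℝ}
    (hξ : x.1 ∈ Ioo (0 : ℝ) 1) (hφ : x.2 ∈ Ioo (-(Real.pi / 2)) (Real.pi / 2))
    (h : Retro q (initialState a x)) :
    Scatters (hollow a q) ⟨-a, -1⟩ ⟨a, -1⟩ x.1 x.2 x.2 := by
  have hc : 0 < Real.cos x.2 := Real.cos_pos_of_mem_Ioo hφ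
  obtain ⟨h1, n, ⟨h2, h3, h4⟩, h5, h6⟩ := h
  have key := exits_up ha hq₀ hq₁ hc h1 h2 h3 h4 h5
  rw [h6] at key
  refine (scatters_hollow_iff ha).2 ⟨⟨hφ.1.le, hφ.2.le⟩, ?_, ?_⟩
  · rw [abs_lt]; constructor <;> linarith [hξ.1, hξ.2]
  · have e : a * (Real.cos x.2 * (-Real.tan x.2 / a)) = -Real.sin x.2 := by
      rw [Real.tan_eq_sin_div_cos]; field_simp
    have e1 : vel a (Real.cos x.2) 1 (initialState a x).1 = ⟨-Real.sin x.2, Real.cos x.2⟩ := by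
      simp only [vel, initialState, e, one_mul]
    have e2 : vel a (Real.cos x.2) (-1) (-(initialState a x).1) =
        ⟨Real.sin x.2, -Real.cos x.2⟩ := by
      simp only [vel, initialState, mul_neg, e, neg_neg, neg_mul, one_mul]
    rwa [e1, e2] at key

/-! ### The initial measure -/

theorem angleMeasure_le : angleMeasure ≤ volume := by
  refine le_trans (withDensity_mono (g := fun _ => 1) (ae_of_all _ fun φ => ?_)) ?_
  · rw [← ENNReal.ofReal_one]
    exact ENNReal.ofReal_le_ofReal (by linarith [Real.cos_le_one φ])
  · simp only [withDensity_const, one_smul]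
    exact Measure.restrict_le_self

theorem measurePreserving_neg_angleMeasure :
    MeasurePreserving (fun φ : ℝ => -φ) angleMeasure angleMeasure := by
  refine ⟨measurable_neg, ?_⟩
  have hm : Measurable fun φ => ENNReal.ofReal (Real.cos φ / 2) := by fun_prop
  rw [angleMeasure, ← withDensity_indicator measurableSet_Icc]
  set f := (Icc (-(Real.pi / 2)) (Real.pi / 2)).indicator fun φ => ENNReal.ofReal (Real.cos φ / 2)
  have hf : Measurable f := hm.indicator measurableSet_Icc
  have heven : ∀ φ, f (-φ) = f φ := by
    intro φ
    simp only [f, indicator, mem_Icc, Real.cos_neg]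
    congr 1
    simp only [eq_iff_iff]
    constructor <;> rintro ⟨h1, h2⟩ <;> constructor <;> linarith
  ext s hs
  rw [Measure.map_apply measurable_neg hs, withDensity_apply _ (measurable_neg hs),
    withDensity_apply _ hs,
    ← (Measure.measurePreserving_neg (volume : Measure ℝ)).setLIntegral_comp_preimage hs hf]
  simp only [heven]

theorem ae_angleMeasure : ∀ᵐ φ ∂angleMeasure, φ ∈ Ioo (-(Real.pi / 2)) (Real.pi / 2) := by
  refine (withDensity_absolutelyContinuous _ _).ae_le ?_
  rw [← restrict_Ioo_eq_restrict_Icc]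
  exact ae_restrict_mem measurableSet_Ioo

theorem ae_initialMeasure : ∀ᵐ x ∂initialMeasure,
    x.1 ∈ Ioo (0 : ℝ) 1 ∧ x.2 ∈ Ioo (-(Real.pi / 2)) (Real.pi / 2) := by
  have h : ∀ᵐ ξ ∂(volume.restrict (Icc (0 : ℝ) 1)), ξ ∈ Ioo (0 : ℝ) 1 := by
    rw [← restrict_Ioo_eq_restrict_Icc]
    exact ae_restrict_mem measurableSet_Ioo
  exact (Measure.quasiMeasurePreserving_fst.ae h).and
    (Measure.quasiMeasurePreserving_snd.ae ae_angleMeasure)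

/-- The distribution of the initial slope. -/
def slopeMeasure (a : ℝ) : Measure ℝ := angleMeasure.map fun φ => -Real.tan φ / a

instance (a : ℝ) : IsFiniteMeasure (slopeMeasure a) := by
  unfold slopeMeasure; infer_instance

theorem measurable_slope (a : ℝ) : Measurable fun φ : ℝ => -Real.tan φ / a := by
  have : Measurable Real.tan := by
    have : Real.tan = fun x => Real.sin x / Real.cos x := funext Real.tan_eq_sin_div_cos
    rw [this]
    fun_prop
  fun_prop

theorem measurable_initialState (a : ℝ) : Measurable (initialState a) :=
  ((measurable_slope a).comp measurable_snd).prodMk (by fun_prop)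

theorem measurePreserving_neg_slopeMeasure (a : ℝ) :
    MeasurePreserving (fun τ : ℝ => -τ) (slopeMeasure a) (slopeMeasure a) := by
  refine ⟨measurable_neg, ?_⟩
  rw [slopeMeasure, Measure.map_map measurable_neg (measurable_slope a)]
  conv_rhs => rw [← measurePreserving_neg_angleMeasure.map_eq,
    Measure.map_map (measurable_slope a) measurable_neg]
  congr 1
  funext φ
  simp only [Function.comp, Real.tan_neg]
  ring

/-- The substitution y = 2ξ - 1 halves the density, so the invariant measure dominates the image,
and domination suffices for upper bounds. -/
theorem map_initialState_le (a : ℝ) :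
    initialMeasure.map (initialState a) ≤ (slopeMeasure a).prod volume := by
  refine Measure.le_iff.2 fun s hs => ?_
  rw [Measure.map_apply (measurable_initialState a) hs, initialMeasure,
    Measure.prod_apply_symm (measurable_initialState a hs), Measure.prod_apply hs, slopeMeasure,
    lintegral_map (measurable_measure_prodMk_left hs) (measurable_slope a)]
  refine lintegral_mono fun φ => (Measure.restrict_apply_le _ _).trans ?_
  set A : Set ℝ := Prod.mk (-Real.tan φ / a) ⁻¹' s
  change volume ((fun ξ : ℝ => 2 * ξ - 1) ⁻¹' A) ≤ volume A
  have hA : MeasurableSet A := measurable_prodMk_left hs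
  have e : (fun ξ : ℝ => 2 * ξ - 1) ⁻¹' A = (fun ξ => 2 * ξ) ⁻¹' ((fun y => y - 1) ⁻¹' A) := rfl
  rw [e, Real.volume_preimage_mul_left two_ne_zero,
    (measurePreserving_sub_right volume (1 : ℝ)).measure_preimage hA.nullMeasurableSet]
  refine mul_le_of_le_one_left zero_le (ENNReal.ofReal_le_one.2 ?_)
  rw [abs_of_pos] <;> norm_num

/-! ### Distance in norm -/

/-- The two images differ by at most μ B on every measurable set; the factor 2 accounts for the
positive and the negative Jordan part. -/
theorem normDist_map_le {X Y : Type*} [MeasurableSpace X] [MeasurableSpace Y] {μ : Measure X}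
    [IsFiniteMeasure μ] {R B : Set X} (hR : MeasurableSet R) {f g : X → Y}
    (hf : AEMeasurable f (μ.restrict R)) (hg : Measurable g)
    (hB : ∀ x ∉ B, x ∈ R ∧ f x = g x) :
    normDist ((μ.restrict R).map f) (μ.map g) ≤ 2 * μ B := by
  set s := ((μ.restrict R).map f).toSignedMeasure - (μ.map g).toSignedMeasure with hs
  have key : ∀ i, MeasurableSet i → |s i| ≤ (μ B).toReal := by
    intro i hi
    have e1 : (μ.restrict R).map f i = μ (f ⁻¹' i ∩ R) := by
      rw [Measure.map_apply_of_aemeasurable hf hi, Measure.restrict_apply' hR]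
    have e2 : μ.map g i = μ (g ⁻¹' i) := Measure.map_apply hg hi
    have h1 : μ (f ⁻¹' i ∩ R) ≤ μ (g ⁻¹' i) + μ B := by
      refine (measure_mono fun x hx => ?_).trans (measure_union_le _ _)
      by_cases hxB : x ∈ B
      · exact .inr hxB
      · left
        have := hx.1
        rwa [mem_preimage, (hB x hxB).2] at this
    have h2 : μ (g ⁻¹' i) ≤ μ (f ⁻¹' i ∩ R) + μ B := by
      refine (measure_mono fun x hx => ?_).trans (measure_union_le _ _)
      by_cases hxB : x ∈ B
      · exact .inr hxB
      · refine .inl ⟨?_, (hB x hxB).1⟩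
        rwa [mem_preimage, (hB x hxB).2]
    have h1' := ENNReal.toReal_mono (by finiteness) h1
    have h2' := ENNReal.toReal_mono (by finiteness) h2
    rw [ENNReal.toReal_add (by finiteness) (by finiteness)] at h1' h2'
    rw [hs, sub_apply, Measure.toSignedMeasure_apply_measurable hi,
      Measure.toSignedMeasure_apply_measurable hi, measureReal_def, measureReal_def, e1, e2, abs_le]
    constructor <;> linarith
  have fin : ∀ c : NNReal, (c : ℝ) ≤ (μ B).toReal → (c : ENNReal) ≤ μ B := by
    intro c hc
    rw [← ENNReal.ofReal_coe_nnreal]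
    exact ENNReal.ofReal_le_of_le_toReal hc
  obtain ⟨i, hi, h1, h2, h3, h4⟩ := s.toJordanDecomposition_spec
  rw [normDist, SignedMeasure.totalVariation, ← hs, Measure.add_apply, h3, h4,
    SignedMeasure.toMeasureOfZeroLE_apply _ _ _ MeasurableSet.univ,
    SignedMeasure.toMeasureOfLEZero_apply _ _ _ MeasurableSet.univ, two_mul]
  refine add_le_add (fin _ ?_) (fin _ ?_)
  · exact (le_abs_self _).trans (key _ (hi.inter MeasurableSet.univ))
  · exact (neg_le_abs _).trans (key _ (hi.compl.inter MeasurableSet.univ))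

theorem retroMeasure_eq_map : retroMeasure = initialMeasure.map fun x => (x.2, x.2) := by
  have h : initialMeasure.map Prod.snd = angleMeasure := by
    rw [initialMeasure, Measure.map_snd_prod]
    simp
  rw [retroMeasure, ← h, Measure.map_map (by fun_prop) measurable_snd]
  rfl

/-! ### The limit -/

theorem tendsto_ratio {α : ℝ} (hα : α ∈ Ioo 0 Real.pi) :
    Tendsto (fun β => ratio α β) (𝓝[>] 0) (𝓝[<] 1) := by
  have ht : 0 < Real.tan (α / 2) :=
    Real.tan_pos_of_pos_of_lt_pi_div_two (by linarith [hα.1]) (by linarith [hα.2])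
  have hc : Real.cos (α / 2) ≠ 0 :=
    (Real.cos_pos_of_mem_Ioo ⟨by linarith [hα.1, Real.pi_pos], by linarith [hα.2]⟩).ne'
  refine tendsto_nhdsWithin_iff.2 ⟨?_, ?_⟩
  · have h1 : Tendsto (fun β : ℝ => (α + β) / 2) (𝓝[>] 0) (𝓝 (α / 2)) := by
      have : Continuous fun β : ℝ => (α + β) / 2 := by fun_prop
      simpa using (this.tendsto 0).mono_left nhdsWithin_le_nhds
    have h2 := (tendsto_const_nhds (x := Real.tan (α / 2))).div
      ((Real.continuousAt_tan.2 hc).tendsto.comp h1) ht.ne'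
    rw [div_self ht.ne'] at h2
    exact h2
  · filter_upwards [Ioo_mem_nhdsGT (show 0 < Real.pi - α by linarith [hα.2])] with β hβ
    have : Real.tan (α / 2) < Real.tan ((α + β) / 2) :=
      Real.tan_lt_tan_of_lt_of_lt_pi_div_two (by linarith [hα.1, Real.pi_pos])
        (by linarith [hβ.2]) (by linarith [hβ.1])
    exact (div_lt_one (ht.trans this)).2 this

/-- A normalized slope of absolute value at most 1 means |tan φ| ≤ tan(α/2), an interval of angles
of length α. -/
theorem measure_flat_angles_le {α : ℝ} (hα : α ∈ Ioo 0 Real.pi) :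
    initialMeasure {x | ¬ 1 < |(initialState (Real.tan (α / 2)) x).1|} ≤ ENNReal.ofReal α := by
  have ht : 0 < Real.tan (α / 2) :=
    Real.tan_pos_of_pos_of_lt_pi_div_two (by linarith [hα.1]) (by linarith [hα.2])
  calc initialMeasure {x | ¬ 1 < |(initialState (Real.tan (α / 2)) x).1|}
      ≤ initialMeasure (univ ×ˢ Icc (-(α / 2)) (α / 2)) := by
        refine measure_mono_ae ?_
        filter_upwards [ae_initialMeasure] with x hx hx'
        have hx' : |-Real.tan x.2 / Real.tan (α / 2)| ≤ 1 := not_lt.1 hx'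
        rw [abs_div, abs_neg, abs_of_pos ht, div_le_one ht, abs_le, ← Real.tan_neg] at hx'
        have hφ := hx.2
        have hα' : α / 2 ∈ Ioo (-(Real.pi / 2)) (Real.pi / 2) :=
          ⟨by linarith [hα.1, Real.pi_pos], by linarith [hα.2]⟩
        have hα'' : -(α / 2) ∈ Ioo (-(Real.pi / 2)) (Real.pi / 2) :=
          ⟨by linarith [hα.2], by linarith [hα.1, Real.pi_pos]⟩
        exact ⟨mem_univ _, (Real.strictMonoOn_tan.le_iff_le hα'' hφ).1 hx'.1,
          (Real.strictMonoOn_tan.le_iff_le hφ hα').1 hx'.2⟩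
    _ = angleMeasure (Icc (-(α / 2)) (α / 2)) := by
        rw [initialMeasure, Measure.prod_prod]; simp
    _ ≤ ENNReal.ofReal α := by
        refine (angleMeasure_le _).trans_eq ?_
        rw [Real.volume_Icc]; congr 1; ring

/-- With α fixed, β → 0 drives the ratio to 1. The flat angles and the particles that are not
retroreflected contribute mass α each; β ≤ α² is there to give β/α ≤ α. -/
theorem exists_size {α : ℝ} (hα : α ∈ Ioo 0 Real.pi) : ∃ β : ℝ, 0 < β ∧ α + β < Real.pi ∧
    β ≤ α ^ 2 ∧ normDist (eta α β) retroMeasure ≤ 2 * ENNReal.ofReal (2 * α) := by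
  set a := Real.tan (α / 2) with ha_def
  have ha : 0 < a :=
    Real.tan_pos_of_pos_of_lt_pi_div_two (by linarith [hα.1]) (by linarith [hα.2])
  have hev := eventually_measure_not_retro_le (measurePreserving_neg_slopeMeasure a)
    (map_initialState_le a) (ENNReal.ofReal_pos.2 hα.1)
  have hpos : ∀ᶠ q in 𝓝[<] (1 : ℝ), 0 < q :=
    (lt_mem_nhds (zero_lt_one' ℝ)).filter_mono nhdsWithin_le_nhds
  have e1 : ∀ᶠ β in 𝓝[>] (0 : ℝ), β ∈ Ioo 0 (Real.pi - α) :=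
    Ioo_mem_nhdsGT (by linarith [hα.2])
  have e2 : ∀ᶠ β in 𝓝[>] (0 : ℝ), β ∈ Ioo 0 (α ^ 2) := Ioo_mem_nhdsGT (pow_pos hα.1 2)
  obtain ⟨β, hβ, hβ', ⟨hret, hq₀⟩, hq₁⟩ := (e1.and (e2.and ((tendsto_ratio hα).eventually
    ((hev.and hpos).and self_mem_nhdsWithin)))).exists
  refine ⟨β, hβ.1, by linarith [hβ.2], hβ'.2.le, ?_⟩
  set q := ratio α β with hq_def
  have hq₁ : q < 1 := hq₁
  set R := regularData (hollow a q) ⟨-a, -1⟩ ⟨a, -1⟩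
  set B : Set (ℝ × ℝ) := {x | ¬ (x ∈ R ∧ exitAngle (hollow a q) ⟨-a, -1⟩ ⟨a, -1⟩ x = x.2)}
  have hR : MeasurableSet R := (isOpen_regularData ha hq₀ hq₁).measurableSet
  have hB : initialMeasure B ≤ ENNReal.ofReal (2 * α) := by
    set S : Set (ℝ × ℝ) := {x | 1 < |x.1| ∧ |x.2| < 1 ∧ ¬ Retro q x}
    calc initialMeasure B ≤ initialMeasure
          ({x | ¬ 1 < |(initialState a x).1|} ∪ initialState a ⁻¹' S) := by
          refine measure_mono_ae ?_
          filter_upwards [ae_initialMeasure] with x hx hxB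
          by_contra hcon
          have hcon' : ¬ (¬ 1 < |(initialState a x).1| ∨ initialState a x ∈ S) := hcon
          rw [not_or, not_not] at hcon'
          have hy : |(initialState a x).2| < 1 := by
            rw [initialState, abs_lt]
            constructor <;> linarith [hx.1.1, hx.1.2]
          have hretro : Retro q (initialState a x) := by
            by_contra hn
            exact hcon'.2 ⟨hcon'.1, hy, hn⟩
          have hsc := hretro.scatters ha hq₀ hq₁ hx.1 hx.2
          exact hxB ⟨⟨_, hsc⟩, exitAngle_of_scatters ha hsc⟩
      _ ≤ ENNReal.ofReal α + ENNReal.ofReal α := by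
          refine (measure_union_le _ _).trans (add_le_add (measure_flat_angles_le hα) ?_)
          exact (Measure.le_map_apply (measurable_initialState a).aemeasurable _).trans hret
      _ = ENNReal.ofReal (2 * α) := by
          rw [← ENNReal.ofReal_add hα.1.le hα.1.le, two_mul]
  have hf : AEMeasurable (fun x : ℝ × ℝ => (x.2, exitAngle (hollow a q) ⟨-a, -1⟩ ⟨a, -1⟩ x))
      (initialMeasure.restrict R) :=
    measurable_snd.aemeasurable.prodMk ((continuousOn_exitAngle ha hq₀ hq₁).aemeasurable hR)
  have hmain := normDist_map_le hR hf (g := fun x : ℝ × ℝ => (x.2, x.2)) (B := B) (by fun_prop)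
    (fun x hx => by
      have hx' := not_not.1 hx
      exact ⟨hx'.1, by rw [hx'.2]⟩)
  have heq : normDist (eta α β) retroMeasure = normDist ((initialMeasure.restrict R).map
      fun x : ℝ × ℝ => (x.2, exitAngle (hollow a q) ⟨-a, -1⟩ ⟨a, -1⟩ x))
      (initialMeasure.map fun x : ℝ × ℝ => (x.2, x.2)) := by
    simp only [retroMeasure_eq_map]
    rfl
  rw [heq]
  exact hmain.trans (mul_le_mul_right hB 2)

end Limit

end NotchedAngle

end

theorem mainTheorem1 :
    ∃ β : ℝ → ℝ,
      (∀ α ∈ Set.Ioo 0 Real.pi, 0 < β α ∧ α + β α < Real.pi) ∧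
      Filter.Tendsto (fun α => β α / α) (nhdsWithin 0 (Set.Ioi 0)) (nhds 0) ∧
      Filter.Tendsto
        (fun α => NotchedAngle.normDist (NotchedAngle.eta α (β α)) NotchedAngle.retroMeasure)
        (nhdsWithin 0 (Set.Ioi 0)) (nhds 0) := by
  classical
  choose! β hβ using fun (α : ℝ) (hα : α ∈ Set.Ioo 0 Real.pi) => NotchedAngle.exists_size hα
  have hmem : Set.Ioo 0 Real.pi ∈ 𝓝[>] (0 : ℝ) := Ioo_mem_nhdsGT Real.pi_pos
  refine ⟨β, fun α hα => ⟨(hβ α hα).1, (hβ α hα).2.1⟩, ?_, ?_⟩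
  · refine squeeze_zero' ?_ ?_ (tendsto_id.mono_left nhdsWithin_le_nhds)
    · filter_upwards [hmem] with α hα
      exact (div_pos (hβ α hα).1 hα.1).le
    · filter_upwards [hmem] with α hα
      rw [id, div_le_iff₀ hα.1, ← sq]
      exact (hβ α hα).2.2.1
  · have hlim : Tendsto (fun α : ℝ => 2 * ENNReal.ofReal (2 * α)) (𝓝[>] 0) (𝓝 0) := by
      have : Tendsto (fun α : ℝ => ENNReal.ofReal (2 * α)) (𝓝[>] 0) (𝓝 (ENNReal.ofReal (2 * 0))) :=
        (ENNReal.continuous_ofReal.comp (by fun_prop : Continuous fun α : ℝ => 2 * α)).tendsto 0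
          |>.mono_left nhdsWithin_le_nhds
      simpa using ENNReal.Tendsto.const_mul this (.inr ENNReal.ofNat_ne_top)
    refine tendsto_of_tendsto_of_tendsto_of_le_of_le' tendsto_const_nhds hlim
      (Eventually.of_forall fun _ => zero_le) ?_
    filter_upwards [hmem] with α hα
    exact (hβ α hα).2.2.2
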